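/- Let $n\ge 3$, $m=3\binom n2+2\binom n3$, and write $[x,y]=x^{-1}y^{-1}xy$. Let $G_n$ be the group with generators $a_1,\dots,a_n,b_1,\dots,b_n$ and the following defining relations, where $u_{ij}=[a_i,a_j]$, $v_{ij}=[b_i,b_j]$, $p_{ij}=[a_i,b_j]$, $z_{ijk}=[p_{ij},a_k]$, $t_{ijk}=[p_{ij},b_k]$: - $[a_i,b_i]=1$, $a_i^4=b_i^4=1$, and $a_i^2,b_i^2$ are central, for all $i$; - $u_{ij}=u_{ji}$, $v_{ij}=v_{ji}$, $p_{ij}=p_{ji}$, $u_{ij}^2=v_{ij}^2=p_{ij}^2=1$, and $u_{ij},v_{ij}$ are central, for $i<j$; - $z_{ijk}=z_{jik}=z_{kij}$, $t_{ijk}=t_{jik}=t_{kij}$, $z_{ijk}^2=t_{ijk}^2=1$, and $z_{ijk},t_{ijk}$ are central, for pairwise distinct $i,j,k$. Let $\mathcal E$ be the variety of Moufang loops satisfying the identities $$x^4=1,\quad [x,y]^2=1,\quad (x,y,z)^2=1,\quad [x^2,y]=1,\quad [[x,y],t]=1,\quad [(x,y,z),t]=1,$$ $$(x^2,y,z)=1,\quad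 ([x,y],z,t)=1,\quad ((x,y,z),t,s)=1,$$ where the loop commutator and associator are given by $xy=(yx)[x,y]$ and $(xy)z=(x(yz))(x,y,z)$. A code loop is a Moufang loop $L$ with a central subgroup $A$ of order $2$ such that $L/A$ is an elementary abelian $2$-group. Then $\mathcal E$ is the variety generated by all code loops; $G_n$ is nilpotent of class $3$ and $|G_n|=2^{4n+m}$; and there are automorphisms $\sigma,\rho$ of $G_n$ with $a_i^\sigma=b_i$, $b_i^\sigma=a_i$, $a_i^\rho=b_i$, $b_i^\rho=a_i^{-1}b_i^{-1}$ for all $i$, of orders $2$ and $3$, with $(\sigma\rho)^2=1$, for which $G_n$ is a group with triality, that is, $$(x^{-1}x^\sigma)(x^{-1}x^\sigma)^{\rho}(x^{-1}x^\sigma)^{\rho^2}=1\quad\text{for all }x\in G_n .$$ Moreover the set $L(G_n)=\{x^{-1}x^\sigma : x\in G_n\}$ with the product $m\cdot k=m^{-\rho}\,k\,m^{-\rho^2}$ is a Moufang loop isomorphic to the free loop $\mathcal F_n$ of rank $n$ in $\mathcal E$; in fact it is a free loop in $\mathcal E$ with free generators $a_i^{-1}a_i^\sigma$, $i=1,\dots,n$.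 -/

import Mathlib

universe u

/-! ### Loops, Moufang loops and code loops -/

/-- A loop: a multiplication with identity element for which `a * x = b` and `x * a = b`
are uniquely solvable. -/
structure IsLoop (L : Type u) [MulOneClass L] : Prop where
  existsUnique_mul_left : ∀ a b : L, ∃! x : L, a * x = b
  existsUnique_mul_right : ∀ a b : L, ∃! x : L, x * a = b

/-- In a loop, `leftDiv a b` is the unique solution `x` of `a * x = b`. -/
noncomputable def leftDiv {L : Type u} [MulOneClass L] (a b : L) : L :=
  Classical.epsilon fun x : L => a * x = b

/-- In a loop, `rightDiv b a` is the unique solution `x` of `x * a = b`. -/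
noncomputable def rightDiv {L : Type u} [MulOneClass L] (b a : L) : L :=
  Classical.epsilon fun x : L => x * a = b

theorem IsLoop.mul_leftDiv {L : Type u} [MulOneClass L] (h : IsLoop L) (a b : L) :
    a * leftDiv a b = b :=
  Classical.epsilon_spec (h.existsUnique_mul_left a b).exists

theorem IsLoop.rightDiv_mul {L : Type u} [MulOneClass L] (h : IsLoop L) (b a : L) :
    rightDiv b a * a = b :=
  Classical.epsilon_spec (h.existsUnique_mul_right a b).exists

/-- The loop commutator: the unique `c` with `x * y = (y * x) * c`. -/
noncomputable def loopCommutator {L : Type u} [MulOneClass L] (x y : L) : L :=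
  leftDiv (y * x) (x * y)

/-- The loop associator: the unique `c` with `(x * y) * z = (x * (y * z)) * c`. -/
noncomputable def loopAssociator {L : Type u} [MulOneClass L] (x y z : L) : L :=
  leftDiv (x * (y * z)) ((x * y) * z)

/-- A Moufang loop: a loop with the left, right and middle Moufang identities (which are
equivalent to one another in every loop). -/
structure IsMoufangLoop (L : Type u) [MulOneClass L] : Prop extends IsLoop L where
  moufang_left : ∀ x y z : L, ((x * y) * x) * z = x * (y * (x * z))
  moufang_right : ∀ x y z : L, ((x * y) * z) * y = x * (y * (z * y))
  moufang_middle : ∀ x y z : L, (x * y) * (z * x) = (x * (y * z)) * x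

/-- A code loop: a Moufang loop `L` with a central subgroup `A` of order `2` such that `L / A` is
an elementary abelian `2`-group `V`. The quotient is given by its projection `π : L → V`, a
surjective homomorphism with kernel `A`. -/
structure IsCodeLoop (L : Type u) [MulOneClass L] : Prop extends IsMoufangLoop L where
  exists_central : ∃ A : Submonoid L, (A : Set L) ⊆ Set.center L ∧ Nat.card A = 2 ∧
    ∃ (V : Type u) (_ : CommGroup V) (π : L →* V), Function.Surjective π ∧
      (∀ v : V, v * v = 1) ∧ ∀ x : L, π x = 1 ↔ x ∈ A

/-! ### The variety `𝓔` -/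

/-- The variety `𝓔` of Moufang loops, given by its defining identities. -/
structure InVarietyE (L : Type u) [MulOneClass L] : Prop extends IsMoufangLoop L where
  pow_four : ∀ x : L, (x * x) * (x * x) = 1
  commutator_sq : ∀ x y : L, loopCommutator x y * loopCommutator x y = 1
  associator_sq : ∀ x y z : L, loopAssociator x y z * loopAssociator x y z = 1
  commutator_of_sq : ∀ x y : L, loopCommutator (x * x) y = 1
  commutator_of_commutator : ∀ x y t : L, loopCommutator (loopCommutator x y) t = 1
  commutator_of_associator : ∀ x y z t : L, loopCommutator (loopAssociator x y z) t = 1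
  associator_of_sq : ∀ x y z : L, loopAssociator (x * x) y z = 1
  associator_of_commutator : ∀ x y z t : L, loopAssociator (loopCommutator x y) z t = 1
  associator_of_associator : ∀ x y z t s : L, loopAssociator (loopAssociator x y z) t s = 1

/-- Terms in the language of loops, in the variables `0, 1, 2, …`. -/
inductive LoopTerm : Type
  | var : ℕ → LoopTerm
  | one : LoopTerm
  | mul : LoopTerm → LoopTerm → LoopTerm
  | leftDiv : LoopTerm → LoopTerm → LoopTerm
  | rightDiv : LoopTerm → LoopTerm → LoopTerm

/-- The value of a term in a loop. -/
noncomputable def LoopTerm.eval {L : Type u} [MulOneClass L] (v : ℕ → L) : LoopTerm → L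
  | .var i => v i
  | .one => 1
  | .mul s t => s.eval v * t.eval v
  | .leftDiv s t => _root_.leftDiv (s.eval v) (t.eval v)
  | .rightDiv s t => _root_.rightDiv (s.eval v) (t.eval v)

/-- The identity `s = t` holds in `L`. -/
def SatisfiesIdentity (L : Type u) [MulOneClass L] (s t : LoopTerm) : Prop :=
  ∀ v : ℕ → L, s.eval v = t.eval v

/-- `L` belongs to the variety generated by code loops: `L` is a loop in which every identity
holds that holds in all code loops. (An identity that fails in a code loop fails in a countable
code loop, so code loops in `Type` suffice.) -/
def InVarietyGeneratedByCodeLoops (L : Type u) [MulOneClass L] : Prop :=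
  IsLoop L ∧ ∀ s t : LoopTerm,
    (∀ (C : Type) [MulOneClass C], IsCodeLoop C → SatisfiesIdentity C s t) →
      SatisfiesIdentity L s t

/-- `F` is a free loop in the variety `𝓔` with free generators `x 0, …, x (n - 1)`. -/
def IsFreeLoopInE {n : ℕ} (F : Type) [MulOneClass F] (x : Fin n → F) : Prop :=
  InVarietyE F ∧ ∀ (L : Type u) [MulOneClass L], InVarietyE L →
    ∀ y : Fin n → L, ∃! f : F →* L, ∀ i, f (x i) = y i

/-! ### Groups with triality and their Moufang loops -/

/-- `G` is a group with triality `S = ⟨σ, ρ⟩`: the automorphisms `σ` and `ρ` have orders `2`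
and `3` and satisfy `(σ ρ)² = 1` (so `S ≅ S₃`), and
`[x, σ] [x, σ]^ρ [x, σ]^(ρ²) = 1` for all `x`, where `[x, σ] = x⁻¹ x^σ`. -/
structure IsTriality {G : Type u} [Group G] (σ ρ : MulAut G) : Prop where
  orderOf_sigma : orderOf σ = 2
  orderOf_rho : orderOf ρ = 3
  sigma_mul_rho_sq : (σ * ρ) ^ 2 = 1
  triality : ∀ x : G, (x⁻¹ * σ x) * ρ (x⁻¹ * σ x) * ρ (ρ (x⁻¹ * σ x)) = 1

namespace IsTriality

variable {G : Type u} [Group G] {σ ρ : MulAut G}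

theorem sigma_sigma (h : IsTriality σ ρ) (x : G) : σ (σ x) = x := by
  have h1 : σ ^ 2 = 1 := h.orderOf_sigma ▸ pow_orderOf_eq_one σ
  have h2 := DFunLike.congr_fun h1 x
  simpa [pow_two] using h2

theorem rho_rho_rho (h : IsTriality σ ρ) (x : G) : ρ (ρ (ρ x)) = x := by
  have h1 : ρ ^ 3 = 1 := h.orderOf_rho ▸ pow_orderOf_eq_one ρ
  have h2 := DFunLike.congr_fun h1 x
  simpa [pow_succ] using h2

theorem sigma_rho (h : IsTriality σ ρ) (x : G) : σ (ρ x) = ρ (ρ (σ x)) := by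
  have h2 := DFunLike.congr_fun h.sigma_mul_rho_sq x
  have h3 : σ (ρ (σ (ρ x))) = x := by simpa [pow_two] using h2
  have h4 : ρ (σ (ρ x)) = σ x := by rw [← h.sigma_sigma (ρ (σ (ρ x))), h3]
  rw [← h4, h.rho_rho_rho]

/-- The set `{x⁻¹ x^σ | x ∈ G}`, the underlying set of the Moufang loop `L(G)`. -/
def LoopOf {G : Type u} [Group G] {σ ρ : MulAut G} (_h : IsTriality σ ρ) : Type u :=
  {m : G // ∃ x : G, m = x⁻¹ * σ x}

/-- The element `x⁻¹ x^σ` of `L(G)`. -/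
def toLoop (h : IsTriality σ ρ) (x : G) : h.LoopOf :=
  ⟨x⁻¹ * σ x, x, rfl⟩

theorem sigma_eq_inv (h : IsTriality σ ρ) {m : G} (hm : ∃ x : G, m = x⁻¹ * σ x) :
    σ m = m⁻¹ := by
  obtain ⟨x, rfl⟩ := hm
  simp [h.sigma_sigma]

theorem mul_mem (h : IsTriality σ ρ) {m k : G} (hm : ∃ x : G, m = x⁻¹ * σ x)
    (hk : ∃ x : G, k = x⁻¹ * σ x) : ∃ x : G, ρ m⁻¹ * k * ρ (ρ m⁻¹) = x⁻¹ * σ x := by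
  obtain ⟨y, rfl⟩ := hk
  refine ⟨y * ρ m, ?_⟩
  rw [map_mul σ, h.sigma_rho, h.sigma_eq_inv hm]
  simp [mul_assoc]

theorem inv_mul_inv (h : IsTriality σ ρ) {m : G} (hm : ∃ x : G, m = x⁻¹ * σ x) :
    ρ m⁻¹ * ρ (ρ m⁻¹) = m := by
  obtain ⟨x, rfl⟩ := hm
  have h1 := h.triality (σ x)
  have h2 : (σ x)⁻¹ * σ (σ x) = (x⁻¹ * σ x)⁻¹ := by simp [h.sigma_sigma]
  rw [h2, mul_assoc] at h1
  exact (inv_mul_eq_one.mp h1).symm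

/-- The multiplication `m · k = m^(-ρ) k m^(-ρ²)` of `L(G)`. -/
instance (h : IsTriality σ ρ) : MulOneClass h.LoopOf where
  one := ⟨1, 1, by simp⟩
  mul m k := ⟨ρ m.1⁻¹ * k.1 * ρ (ρ m.1⁻¹), h.mul_mem m.2 k.2⟩
  one_mul k := Subtype.ext (show ρ 1⁻¹ * k.1 * ρ (ρ 1⁻¹) = k.1 by simp)
  mul_one m := Subtype.ext (show ρ m.1⁻¹ * 1 * ρ (ρ m.1⁻¹) = m.1 by
    rw [mul_one]; exact h.inv_mul_inv m.2)

end IsTriality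

/-! ### The group `G_n` -/

/-- The group commutator `[x, y] = x⁻¹ y⁻¹ x y`. -/
def gcomm {G : Type u} [Group G] (x y : G) : G := x⁻¹ * y⁻¹ * x * y

namespace TrialityGroup

variable (n : ℕ)

/-- The free group on the letters `a_i` (`Sum.inl i`) and `b_i` (`Sum.inr i`). -/
abbrev Words : Type := FreeGroup (Fin n ⊕ Fin n)

variable {n}

/-- The letter `a_i`. -/
def wa (i : Fin n) : Words n := FreeGroup.of (Sum.inl i)

/-- The letter `b_i`. -/
def wb (i : Fin n) : Words n := FreeGroup.of (Sum.inr i)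

/-- `u_ij = [a_i, a_j]`. -/
def wu (i j : Fin n) : Words n := gcomm (wa i) (wa j)

/-- `v_ij = [b_i, b_j]`. -/
def wv (i j : Fin n) : Words n := gcomm (wb i) (wb j)

/-- `p_ij = [a_i, b_j]`. -/
def wp (i j : Fin n) : Words n := gcomm (wa i) (wb j)

/-- `z_ijk = [p_ij, a_k]`. -/
def wz (i j k : Fin n) : Words n := gcomm (wp i j) (wa k)

/-- `t_ijk = [p_ij, b_k]`. -/
def wt (i j k : Fin n) : Words n := gcomm (wp i j) (wb k)

/-- The indices `i, j, k` are pairwise distinct. -/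
def Distinct (i j k : Fin n) : Prop := i ≠ j ∧ i ≠ k ∧ j ≠ k

/-- The defining relations of `G_n`: `IsRelation x y` says that `x = y` is imposed. -/
inductive IsRelation : Words n → Words n → Prop
  | comm_a_b (i : Fin n) : IsRelation (gcomm (wa i) (wb i)) 1
  | a_sq_central (i : Fin n) (g : Words n) : IsRelation (gcomm (wa i ^ 2) g) 1
  | b_sq_central (i : Fin n) (g : Words n) : IsRelation (gcomm (wb i ^ 2) g) 1
  | u_symm (i j : Fin n) : i < j → IsRelation (wu i j) (wu j i)
  | v_symm (i j : Fin n) : i < j → IsRelation (wv i j) (wv j i)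
  | u_sq (i j : Fin n) : i < j → IsRelation (wu i j ^ 2) 1
  | v_sq (i j : Fin n) : i < j → IsRelation (wv i j ^ 2) 1
  | u_central (i j : Fin n) (g : Words n) : i < j → IsRelation (gcomm (wu i j) g) 1
  | v_central (i j : Fin n) (g : Words n) : i < j → IsRelation (gcomm (wv i j) g) 1
  | p_symm (i j : Fin n) : i < j → IsRelation (wp i j) (wp j i)
  | p_sq (i j : Fin n) : i < j → IsRelation (wp i j ^ 2) 1
  | z_swap (i j k : Fin n) : Distinct i j k → IsRelation (wz i j k) (wz j i k)
  | z_cycle (i j k : Fin n) : Distinct i j k → IsRelation (wz j i k) (wz k i j)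
  | t_swap (i j k : Fin n) : Distinct i j k → IsRelation (wt i j k) (wt j i k)
  | t_cycle (i j k : Fin n) : Distinct i j k → IsRelation (wt j i k) (wt k i j)
  | t_sq (i j k : Fin n) : Distinct i j k → IsRelation (wt i j k ^ 2) 1
  | z_sq (i j k : Fin n) : Distinct i j k → IsRelation (wz i j k ^ 2) 1
  | z_central (i j k : Fin n) (g : Words n) : Distinct i j k → IsRelation (gcomm (wz i j k) g) 1
  | t_central (i j k : Fin n) (g : Words n) : Distinct i j k → IsRelation (gcomm (wt i j k) g) 1
  | a_pow_four (i : Fin n) : IsRelation (wa i ^ 4) 1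
  | b_pow_four (i : Fin n) : IsRelation (wb i ^ 4) 1

end TrialityGroup

/-- The group `G_n`, presented by the generators `a_i`, `b_i` and the relations above. -/
abbrev TrialityGroup (n : ℕ) : Type :=
  PresentedGroup {r : TrialityGroup.Words n | ∃ x y, TrialityGroup.IsRelation x y ∧ r = x * y⁻¹}

namespace TrialityGroup

/-- The generator `a_i` of `G_n`. -/
def a {n : ℕ} (i : Fin n) : TrialityGroup n := PresentedGroup.of (Sum.inl i)

/-- The generator `b_i` of `G_n`. -/
def b {n : ℕ} (i : Fin n) : TrialityGroup n := PresentedGroup.of (Sum.inr i)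

end TrialityGroup

-- The group side rests on an explicit model of `G_n`: exponent vectors over Z/2 of normal forms,
-- multiplied by the polynomials that collection produces. The group axioms, the automorphisms and
-- the triality identity become polynomial identities, checked coordinate by coordinate. The model
-- satisfies the defining relations (`TrialityModel.lift_eq_of_isRelation`) and is generated by the
-- images of `a_i`, `b_i` (`TrialityModel.eq_top_of_generators_mem`), so `G_n` maps onto it.
-- Conversely, dividing `G_n` first by its central involutions, then by the images of the `p_ij`,
-- and bounding what is left bounds `|G_n|` by the order of the model
-- (`TrialityGroup.finite_and_card_le`). So `G_n` is the model, and its order, class and triality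
-- are read off there.
--
-- The loop side is a structure theory of `𝓔`. In a loop of `𝓔`, squares, commutators and
-- associators are central of order at most 2. The Moufang identities make the associator symmetric,
-- and the pentagon makes it additive in each argument (`InVarietyE.assoc_mul_left`); the commutator
-- is additive up to an associator (`InVarietyE.comm_mul_left`). Left-normed products of given
-- elements therefore multiply by a universal cocycle with values in squares, commutators and
-- associators of those elements (`InVarietyE.normalProd_mul_normalProd`). Taking these values to be
-- independent gives a central extension `FreeLoop n` of `(Z/2)^n`, which is free in `𝓔`.
--
-- Each scalar component of that cocycle defines a code loop, so `FreeLoop n` embeds in a product of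
-- code loops and satisfies all their identities. An identity has finitely many variables, so every
-- loop of `𝓔` inherits these identities from a free loop. The converse holds because in a code loop
-- squares, commutators and associators lie in a central subgroup of order 2.
--
-- The two sides meet in `TrialityModel.ofFreeLoop`, a bijection from `FreeLoop n` onto the elements
-- `x⁻¹ x^σ` of the model that turns the loop product into `m^(-ρ) k m^(-ρ²)`
-- (`TrialityModel.ofFreeLoop_mul`).

universe v

/-! ### Index sets -/

/-- Pairs `i < j` of indices. -/
abbrev IndexPair (n : ℕ) : Type := {q : Fin n × Fin n // q.1 < q.2}

/-- Triples `i < j < k` of indices. -/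
abbrev IndexTriple (n : ℕ) : Type := {q : Fin n × Fin n × Fin n // q.1 < q.2.1 ∧ q.2.1 < q.2.2}

namespace IndexTriple

variable {n : ℕ} (q : IndexTriple n)

abbrev fst : Fin n := q.1.1
abbrev snd : Fin n := q.1.2.1
abbrev trd : Fin n := q.1.2.2

/-- The pair `(i, j)` of a triple `(i, j, k)`. -/
def pair12 : IndexPair n := ⟨(q.fst, q.snd), q.2.1⟩
/-- The pair `(i, k)` of a triple `(i, j, k)`. -/
def pair13 : IndexPair n := ⟨(q.fst, q.trd), q.2.1.trans q.2.2⟩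
/-- The pair `(j, k)` of a triple `(i, j, k)`. -/
def pair23 : IndexPair n := ⟨(q.snd, q.trd), q.2.2⟩

@[simp] theorem pair12_fst : q.pair12.1.1 = q.fst := rfl
@[simp] theorem pair12_snd : q.pair12.1.2 = q.snd := rfl
@[simp] theorem pair13_fst : q.pair13.1.1 = q.fst := rfl
@[simp] theorem pair13_snd : q.pair13.1.2 = q.trd := rfl
@[simp] theorem pair23_fst : q.pair23.1.1 = q.snd := rfl
@[simp] theorem pair23_snd : q.pair23.1.2 = q.trd := rfl

end IndexTriple

theorem card_indexPair (n : ℕ) : Nat.card (IndexPair n) = n.choose 2 := by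
  have e : IndexPair n ≃ Set.powersetCard (Fin n) 2 := by
    refine Equiv.ofBijective
      (fun q => ⟨{q.1.1, q.1.2}, Finset.card_pair q.2.ne⟩) ⟨?_, ?_⟩
    · rintro ⟨⟨i, j⟩, h⟩ ⟨⟨i', j'⟩, h'⟩ e
      have e' := congrArg Subtype.val e
      simp only [Finset.ext_iff, Finset.mem_insert, Finset.mem_singleton] at e'
      have h1 := e' i
      have h2 := e' j
      have h3 := e' i'
      have h4 := e' j'
      simp only [Subtype.mk.injEq, Prod.mk.injEq]
      dsimp only at h h'
      grind
    · rintro ⟨s, hs⟩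
      obtain ⟨i, j, hij, rfl⟩ := Finset.card_eq_two.mp hs
      rcases lt_or_gt_of_ne hij with h | h
      · exact ⟨⟨(i, j), h⟩, rfl⟩
      · exact ⟨⟨(j, i), h⟩, Subtype.ext (Finset.pair_comm j i)⟩
  rw [Nat.card_congr e, Set.powersetCard.card, Nat.card_fin]

theorem card_indexTriple (n : ℕ) : Nat.card (IndexTriple n) = n.choose 3 := by
  have e : IndexTriple n ≃ Set.powersetCard (Fin n) 3 := by
    refine Equiv.ofBijective
      (fun q => ⟨{q.1.1, q.1.2.1, q.1.2.2}, Finset.card_eq_three.mpr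
        ⟨_, _, _, q.2.1.ne, (q.2.1.trans q.2.2).ne, q.2.2.ne, rfl⟩⟩) ⟨?_, ?_⟩
    · rintro ⟨⟨i, j, k⟩, h⟩ ⟨⟨i', j', k'⟩, h'⟩ e
      have e' := congrArg Subtype.val e
      simp only [Finset.ext_iff, Finset.mem_insert, Finset.mem_singleton] at e'
      have h1 := e' i
      have h2 := e' j
      have h3 := e' k
      have h4 := e' i'
      have h5 := e' j'
      have h6 := e' k'
      simp only [Subtype.mk.injEq, Prod.mk.injEq]
      dsimp only at h h'
      grind
    · rintro ⟨s, hs⟩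
      have hs' : s.card = 3 := hs
      refine ⟨⟨(s.orderEmbOfFin hs' 0, s.orderEmbOfFin hs' 1, s.orderEmbOfFin hs' 2),
        by simp, by simp⟩, Subtype.ext ?_⟩
      ext x
      rw [← Finset.mem_coe (s := s), ← Finset.range_orderEmbOfFin s hs', Set.mem_range]
      simp [Fin.exists_fin_succ, eq_comm]
  rw [Nat.card_congr e, Set.powersetCard.card, Nat.card_fin]

/-! ### A polynomial model of `G_n` -/

/-- The normal forms
`∏ a_i^α_i ∏ b_i^β_i ∏ a_i^(2 s_i) ∏ b_i^(2 r_i) ∏ u_ij^.. ∏ v_ij^.. ∏ p_ij^.. ∏ z_ijk^.. ∏ t_ijk^..`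
of the elements of `G_n`. -/
@[ext]
structure TrialityModel (n : ℕ) : Type where
  α : Fin n → ZMod 2
  β : Fin n → ZMod 2
  s : Fin n → ZMod 2
  r : Fin n → ZMod 2
  u : IndexPair n → ZMod 2
  v : IndexPair n → ZMod 2
  p : IndexPair n → ZMod 2
  z : IndexTriple n → ZMod 2
  t : IndexTriple n → ZMod 2

/-- Most verifications in the model hold in any commutative ring of characteristic 2. Idempotency
matters for the coordinates `s` and `r`, where an exponent gets multiplied by itself. -/
theorem ZMod.two_mul_self (x : ZMod 2) : x * x = x := by revert x; decide

namespace TrialityModel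

variable {n : ℕ}

instance : One (TrialityModel n) where
  one := ⟨0, 0, 0, 0, 0, 0, 0, 0, 0⟩

/-- The formulas come from collecting a product of two normal forms. Merging the letters `a` gives
squares and `u`; moving a `b` of `x` past an `a` of `y` gives `p`. The terms of `z` and `t` arise
when old or newly created `p` are moved past the remaining letters. -/
instance : Mul (TrialityModel n) where
  mul x y :=
    { α := fun i => x.α i + y.α i
      β := fun i => x.β i + y.β i
      s := fun i => x.s i + y.s i + x.α i * y.α i
      r := fun i => x.r i + y.r i + x.β i * y.β i
      u := fun q => x.u q + y.u q + x.α q.1.2 * y.α q.1.1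
      v := fun q => x.v q + y.v q + x.β q.1.2 * y.β q.1.1
      p := fun q => x.p q + y.p q + x.β q.1.1 * y.α q.1.2 + x.β q.1.2 * y.α q.1.1
      z := fun q => x.z q + y.z q + x.p q.pair12 * y.α q.trd + x.p q.pair13 * y.α q.snd +
        x.p q.pair23 * y.α q.fst + x.β q.fst * y.α q.snd * y.α q.trd +
        x.β q.snd * y.α q.fst * y.α q.trd + x.β q.trd * y.α q.fst * y.α q.snd
      t := fun q => x.t q + y.t q + x.p q.pair12 * y.β q.trd + x.p q.pair13 * y.β q.snd +
        x.p q.pair23 * y.β q.fst +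
        x.β q.snd * x.β q.trd * y.α q.fst + x.β q.fst * x.β q.trd * y.α q.snd +
        x.β q.fst * x.β q.snd * y.α q.trd +
        x.β q.fst * (y.β q.snd * y.α q.trd + y.β q.trd * y.α q.snd) +
        x.β q.snd * (y.β q.fst * y.α q.trd + y.β q.trd * y.α q.fst) +
        x.β q.trd * (y.β q.fst * y.α q.snd + y.β q.snd * y.α q.fst) }

instance : Inv (TrialityModel n) where
  inv x :=
    { α := x.α
      β := x.β
      s := fun i => x.s i + x.α i
      r := fun i => x.r i + x.β i
      u := fun q => x.u q + x.α q.1.1 * x.α q.1.2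
      v := fun q => x.v q + x.β q.1.1 * x.β q.1.2
      p := fun q => x.p q + x.α q.1.1 * x.β q.1.2 + x.α q.1.2 * x.β q.1.1
      z := fun q => x.z q + x.p q.pair12 * x.α q.trd + x.p q.pair13 * x.α q.snd +
        x.p q.pair23 * x.α q.fst + x.β q.fst * x.α q.snd * x.α q.trd +
        x.β q.snd * x.α q.fst * x.α q.trd + x.β q.trd * x.α q.fst * x.α q.snd
      t := fun q => x.t q + x.p q.pair12 * x.β q.trd + x.p q.pair13 * x.β q.snd +
        x.p q.pair23 * x.β q.fst + x.α q.fst * x.β q.snd * x.β q.trd +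
        x.α q.snd * x.β q.fst * x.β q.trd + x.α q.trd * x.β q.fst * x.β q.snd }

section Components

variable (x y : TrialityModel n) (i : Fin n) (q : IndexPair n) (w : IndexTriple n)

@[simp] theorem one_α : (1 : TrialityModel n).α i = 0 := rfl
@[simp] theorem one_β : (1 : TrialityModel n).β i = 0 := rfl
@[simp] theorem one_s : (1 : TrialityModel n).s i = 0 := rfl
@[simp] theorem one_r : (1 : TrialityModel n).r i = 0 := rfl
@[simp] theorem one_u : (1 : TrialityModel n).u q = 0 := rfl
@[simp] theorem one_v : (1 : TrialityModel n).v q = 0 := rfl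
@[simp] theorem one_p : (1 : TrialityModel n).p q = 0 := rfl
@[simp] theorem one_z : (1 : TrialityModel n).z w = 0 := rfl
@[simp] theorem one_t : (1 : TrialityModel n).t w = 0 := rfl

@[simp] theorem mul_α : (x * y).α i = x.α i + y.α i := rfl
@[simp] theorem mul_β : (x * y).β i = x.β i + y.β i := rfl
@[simp] theorem mul_s : (x * y).s i = x.s i + y.s i + x.α i * y.α i := rfl
@[simp] theorem mul_r : (x * y).r i = x.r i + y.r i + x.β i * y.β i := rfl
@[simp] theorem mul_u : (x * y).u q = x.u q + y.u q + x.α q.1.2 * y.α q.1.1 := rfl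
@[simp] theorem mul_v : (x * y).v q = x.v q + y.v q + x.β q.1.2 * y.β q.1.1 := rfl
@[simp] theorem mul_p : (x * y).p q =
    x.p q + y.p q + x.β q.1.1 * y.α q.1.2 + x.β q.1.2 * y.α q.1.1 := rfl
@[simp] theorem mul_z : (x * y).z w =
    x.z w + y.z w + x.p w.pair12 * y.α w.trd + x.p w.pair13 * y.α w.snd +
      x.p w.pair23 * y.α w.fst + x.β w.fst * y.α w.snd * y.α w.trd +
      x.β w.snd * y.α w.fst * y.α w.trd + x.β w.trd * y.α w.fst * y.α w.snd := rfl
@[simp] theorem mul_t : (x * y).t w =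
    x.t w + y.t w + x.p w.pair12 * y.β w.trd + x.p w.pair13 * y.β w.snd +
      x.p w.pair23 * y.β w.fst +
      x.β w.snd * x.β w.trd * y.α w.fst + x.β w.fst * x.β w.trd * y.α w.snd +
      x.β w.fst * x.β w.snd * y.α w.trd +
      x.β w.fst * (y.β w.snd * y.α w.trd + y.β w.trd * y.α w.snd) +
      x.β w.snd * (y.β w.fst * y.α w.trd + y.β w.trd * y.α w.fst) +
      x.β w.trd * (y.β w.fst * y.α w.snd + y.β w.snd * y.α w.fst) := rfl

@[simp] theorem inv_α : (x⁻¹).α i = x.α i := rfl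
@[simp] theorem inv_β : (x⁻¹).β i = x.β i := rfl
@[simp] theorem inv_s : (x⁻¹).s i = x.s i + x.α i := rfl
@[simp] theorem inv_r : (x⁻¹).r i = x.r i + x.β i := rfl
@[simp] theorem inv_u : (x⁻¹).u q = x.u q + x.α q.1.1 * x.α q.1.2 := rfl
@[simp] theorem inv_v : (x⁻¹).v q = x.v q + x.β q.1.1 * x.β q.1.2 := rfl
@[simp] theorem inv_p : (x⁻¹).p q =
    x.p q + x.α q.1.1 * x.β q.1.2 + x.α q.1.2 * x.β q.1.1 := rfl
@[simp] theorem inv_z : (x⁻¹).z w = x.z w + x.p w.pair12 * x.α w.trd +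
    x.p w.pair13 * x.α w.snd + x.p w.pair23 * x.α w.fst + x.β w.fst * x.α w.snd * x.α w.trd +
    x.β w.snd * x.α w.fst * x.α w.trd + x.β w.trd * x.α w.fst * x.α w.snd := rfl
@[simp] theorem inv_t : (x⁻¹).t w = x.t w + x.p w.pair12 * x.β w.trd +
    x.p w.pair13 * x.β w.snd + x.p w.pair23 * x.β w.fst + x.α w.fst * x.β w.snd * x.β w.trd +
    x.α w.snd * x.β w.fst * x.β w.trd + x.α w.trd * x.β w.fst * x.β w.snd := rfl

end Components

instance : Group (TrialityModel n) := Group.ofLeftAxioms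
  (fun x y w => by ext q <;> simp <;> grind)
  (fun x => by ext q <;> simp)
  (fun x => by
    ext q <;> simp
    · grind
    · grind
    · grind [ZMod.two_mul_self (x.α q)]
    · grind [ZMod.two_mul_self (x.β q)]
    all_goals grind)

/-- The coordinates of an element of the model. -/
def equivProd (n : ℕ) : TrialityModel n ≃
    ((Fin n → ZMod 2) × (Fin n → ZMod 2)) × ((Fin n → ZMod 2) × (Fin n → ZMod 2)) ×
    ((IndexPair n → ZMod 2) × (IndexPair n → ZMod 2) × (IndexPair n → ZMod 2)) ×
    ((IndexTriple n → ZMod 2) × (IndexTriple n → ZMod 2)) where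
  toFun x := ((x.α, x.β), (x.s, x.r), (x.u, x.v, x.p), (x.z, x.t))
  invFun c := ⟨c.1.1, c.1.2, c.2.1.1, c.2.1.2, c.2.2.1.1, c.2.2.1.2.1, c.2.2.1.2.2, c.2.2.2.1,
    c.2.2.2.2⟩
  left_inv _ := rfl
  right_inv _ := rfl

theorem natCard (n : ℕ) :
    Nat.card (TrialityModel n) = 2 ^ (4 * n + (3 * n.choose 2 + 2 * n.choose 3)) := by
  rw [Nat.card_congr (equivProd n)]
  simp only [Nat.card_prod, Nat.card_fun, card_indexPair, card_indexTriple, Nat.card_zmod,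
    Nat.card_fin]
  ring

end TrialityModel

/-! ### The automorphisms `σ` and `ρ` of the model. -/

namespace TrialityModel

variable {n : ℕ}

/-- The endomorphism `σ` of the model. -/
def sigmaHom (n : ℕ) : TrialityModel n →* TrialityModel n where
  toFun x :=
    { α := x.β
      β := x.α
      s := x.r
      r := x.s
      u := x.v
      v := x.u
      -- Exchanging the letters turns `a^α b^β` into `b^α a^β`; the products here and below come
      -- from collecting this word again.
      p := fun q => x.p q + x.α q.1.1 * x.β q.1.2 + x.α q.1.2 * x.β q.1.1
      z := fun q => x.t q + x.α q.fst * x.β q.snd * x.β q.trd +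
        x.α q.snd * x.β q.fst * x.β q.trd + x.α q.trd * x.β q.fst * x.β q.snd
      t := fun q => x.z q + x.β q.fst * x.α q.snd * x.α q.trd +
        x.β q.snd * x.α q.fst * x.α q.trd + x.β q.trd * x.α q.fst * x.α q.snd }
  map_one' := by ext q <;> simp
  map_mul' x y := by ext q <;> simp <;> grind

/-- The endomorphism `ρ` of the model. -/
def rhoHom (n : ℕ) : TrialityModel n →* TrialityModel n where
  toFun x :=
    { α := x.β
      β := fun i => x.α i + x.β i
      s := fun i => x.β i + x.r i
      r := fun i => x.β i + x.r i + x.s i + x.α i * x.β i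
      -- Modulo `z` and `t`, `ρ` sends `u ↦ v`, `v ↦ u v`, `p ↦ p v`; moreover `z ↦ t` and `t ↦ z
      -- t`. These give the linear parts, and collection of the letters gives the products.
      u := x.v
      v := fun q => x.p q + x.u q + x.v q + x.α q.1.2 * x.β q.1.1
      p := fun q => x.p q + x.α q.1.1 * x.β q.1.2 + x.α q.1.2 * x.β q.1.1 +
        x.β q.1.1 * x.β q.1.2
      z := fun q => x.t q + x.α q.fst * x.β q.snd * x.β q.trd +
        x.α q.snd * x.β q.fst * x.β q.trd + x.α q.trd * x.β q.fst * x.β q.snd +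
        x.β q.fst * x.β q.snd * x.β q.trd
      t := fun q => x.t q + x.z q + x.β q.fst * x.α q.snd * x.α q.trd +
        x.β q.snd * x.α q.fst * x.α q.trd + x.β q.trd * x.α q.fst * x.α q.snd }
  map_one' := by ext q <;> simp
  map_mul' x y := by ext q <;> simp <;> grind

section Components

variable (x : TrialityModel n) (i : Fin n) (q : IndexPair n) (w : IndexTriple n)

@[simp] theorem sigmaHom_α : (sigmaHom n x).α i = x.β i := rfl
@[simp] theorem sigmaHom_β : (sigmaHom n x).β i = x.α i := rfl
@[simp] theorem sigmaHom_s : (sigmaHom n x).s i = x.r i := rfl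
@[simp] theorem sigmaHom_r : (sigmaHom n x).r i = x.s i := rfl
@[simp] theorem sigmaHom_u : (sigmaHom n x).u q = x.v q := rfl
@[simp] theorem sigmaHom_v : (sigmaHom n x).v q = x.u q := rfl
@[simp] theorem sigmaHom_p : (sigmaHom n x).p q =
    x.p q + x.α q.1.1 * x.β q.1.2 + x.α q.1.2 * x.β q.1.1 := rfl
@[simp] theorem sigmaHom_z : (sigmaHom n x).z w =
    x.t w + x.α w.fst * x.β w.snd * x.β w.trd +
      x.α w.snd * x.β w.fst * x.β w.trd + x.α w.trd * x.β w.fst * x.β w.snd := rfl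
@[simp] theorem sigmaHom_t : (sigmaHom n x).t w =
    x.z w + x.β w.fst * x.α w.snd * x.α w.trd +
      x.β w.snd * x.α w.fst * x.α w.trd + x.β w.trd * x.α w.fst * x.α w.snd := rfl

@[simp] theorem rhoHom_α : (rhoHom n x).α i = x.β i := rfl
@[simp] theorem rhoHom_β : (rhoHom n x).β i = x.α i + x.β i := rfl
@[simp] theorem rhoHom_s : (rhoHom n x).s i = x.β i + x.r i := rfl
@[simp] theorem rhoHom_r : (rhoHom n x).r i = x.β i + x.r i + x.s i + x.α i * x.β i := rfl
@[simp] theorem rhoHom_u : (rhoHom n x).u q = x.v q := rfl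
@[simp] theorem rhoHom_v : (rhoHom n x).v q =
    x.p q + x.u q + x.v q + x.α q.1.2 * x.β q.1.1 := rfl
@[simp] theorem rhoHom_p : (rhoHom n x).p q =
    x.p q + x.α q.1.1 * x.β q.1.2 + x.α q.1.2 * x.β q.1.1 + x.β q.1.1 * x.β q.1.2 := rfl
@[simp] theorem rhoHom_z : (rhoHom n x).z w =
    x.t w + x.α w.fst * x.β w.snd * x.β w.trd +
      x.α w.snd * x.β w.fst * x.β w.trd + x.α w.trd * x.β w.fst * x.β w.snd +
      x.β w.fst * x.β w.snd * x.β w.trd := rfl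
@[simp] theorem rhoHom_t : (rhoHom n x).t w =
    x.t w + x.z w + x.β w.fst * x.α w.snd * x.α w.trd +
      x.β w.snd * x.α w.fst * x.α w.trd + x.β w.trd * x.α w.fst * x.α w.snd := rfl

end Components

theorem sigmaHom_sigmaHom (x : TrialityModel n) : sigmaHom n (sigmaHom n x) = x := by
  ext q <;> simp <;> grind

theorem rhoHom_rhoHom_rhoHom (x : TrialityModel n) :
    rhoHom n (rhoHom n (rhoHom n x)) = x := by
  ext q <;> simp
  · grind
  · grind
  · grind [ZMod.two_mul_self (x.α q), ZMod.two_mul_self (x.β q)]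
  · grind [ZMod.two_mul_self (x.α q), ZMod.two_mul_self (x.β q)]
  all_goals grind

theorem sigmaHom_rhoHom_sigmaHom_rhoHom (x : TrialityModel n) :
    sigmaHom n (rhoHom n (sigmaHom n (rhoHom n x))) = x := by
  ext q <;> simp
  · grind
  · grind [ZMod.two_mul_self (x.α q), ZMod.two_mul_self (x.β q)]
  · grind [ZMod.two_mul_self (x.α q), ZMod.two_mul_self (x.β q)]
  all_goals grind

theorem triality (x : TrialityModel n) :
    (x⁻¹ * sigmaHom n x) * rhoHom n (x⁻¹ * sigmaHom n x) *
      rhoHom n (rhoHom n (x⁻¹ * sigmaHom n x)) = 1 := by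
  ext q
  · simp; grind
  · simp; grind
  · simp; grind [ZMod.two_mul_self (x.α q), ZMod.two_mul_self (x.β q)]
  · simp; grind [ZMod.two_mul_self (x.α q), ZMod.two_mul_self (x.β q)]
  · simp; grind
  · simp; grind
  · simp; grind
  · simp; grind
  · simp; grind

/-- The automorphism `σ` of the model. -/
def sigma (n : ℕ) : MulAut (TrialityModel n) :=
  { sigmaHom n with
    invFun := sigmaHom n
    left_inv := sigmaHom_sigmaHom
    right_inv := sigmaHom_sigmaHom }

/-- The automorphism `ρ` of the model. -/
def rho (n : ℕ) : MulAut (TrialityModel n) :=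
  { rhoHom n with
    invFun := fun x => rhoHom n (rhoHom n x)
    left_inv := rhoHom_rhoHom_rhoHom
    right_inv := rhoHom_rhoHom_rhoHom }

theorem sigma_apply (x : TrialityModel n) : sigma n x = sigmaHom n x := rfl
theorem rho_apply (x : TrialityModel n) : rho n x = rhoHom n x := rfl

/-! ### Generators and relations of the model -/

/-- The image of `a_i` in the model. -/
def a (i : Fin n) : TrialityModel n := ⟨Pi.single i 1, 0, 0, 0, 0, 0, 0, 0, 0⟩

/-- The image of `b_i` in the model. -/
def b (i : Fin n) : TrialityModel n := ⟨0, Pi.single i 1, 0, 0, 0, 0, 0, 0, 0⟩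

theorem sigma_a (i : Fin n) : sigma n (a i) = b i := by
  ext q <;> simp [sigma_apply] <;> simp [a, b]

theorem sigma_b (i : Fin n) : sigma n (b i) = a i := by
  ext q <;> simp [sigma_apply] <;> simp [a, b]

/-- A generator involves a single index, so this kills the products over two different indices that
collection contributes. -/
theorem single_eq_zero_or_of_ne {i j k : Fin n} (h : j ≠ k) :
    (Pi.single i 1 : Fin n → ZMod 2) j = 0 ∨ (Pi.single i 1 : Fin n → ZMod 2) k = 0 := by
  rcases eq_or_ne j i with rfl | hj
  · exact Or.inr (Pi.single_eq_of_ne h.symm 1)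
  · exact Or.inl (Pi.single_eq_of_ne hj 1)

theorem rho_a (i : Fin n) : rho n (a i) = b i := by
  ext q <;> simp [rho_apply] <;> simp [a, b]

theorem rho_b (i : Fin n) : rho n (b i) = (a i)⁻¹ * (b i)⁻¹ := by
  ext q <;> simp [rho_apply] <;> simp [a, b]
  · exact single_eq_zero_or_of_ne q.2.ne
  · exact single_eq_zero_or_of_ne q.2.ne
  · exact single_eq_zero_or_of_ne q.2.ne
  · exact Or.inl (single_eq_zero_or_of_ne q.2.1.ne)

theorem orderOf_sigma (hn : 0 < n) : orderOf (sigma n) = 2 := by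
  refine orderOf_eq_prime ?_ ?_
  · exact MulEquiv.ext fun x => sigmaHom_sigmaHom x
  · intro h
    have h1 := DFunLike.congr_fun h (a ⟨0, hn⟩)
    rw [sigma_a] at h1
    have h2 := congrFun (congrArg TrialityModel.β h1) ⟨0, hn⟩
    simp [a, b] at h2

theorem orderOf_rho (hn : 0 < n) : orderOf (rho n) = 3 := by
  refine orderOf_eq_prime ?_ ?_
  · exact MulEquiv.ext fun x => rhoHom_rhoHom_rhoHom x
  · intro h
    have h1 := DFunLike.congr_fun h (a ⟨0, hn⟩)
    rw [rho_a] at h1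
    have h2 := congrFun (congrArg TrialityModel.β h1) ⟨0, hn⟩
    simp [a, b] at h2

theorem sigma_mul_rho_sq (n : ℕ) : (sigma n * rho n) ^ 2 = 1 := by
  rw [pow_two]
  exact MulEquiv.ext fun x => sigmaHom_rhoHom_sigmaHom_rhoHom x

end TrialityModel

/-! ### Commutators and the defining relations in the model. -/

namespace TrialityModel

variable {n : ℕ}

section Commutator

variable (x y : TrialityModel n) (i : Fin n) (q : IndexPair n) (w : IndexTriple n)

@[simp] theorem gcomm_α : (gcomm x y).α i = 0 := by simp [gcomm]; grind
@[simp] theorem gcomm_β : (gcomm x y).β i = 0 := by simp [gcomm]; grind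
@[simp] theorem gcomm_s : (gcomm x y).s i = 0 := by
  simp [gcomm]; grind [ZMod.two_mul_self (x.α i), ZMod.two_mul_self (y.α i)]
@[simp] theorem gcomm_r : (gcomm x y).r i = 0 := by
  simp [gcomm]; grind [ZMod.two_mul_self (x.β i), ZMod.two_mul_self (y.β i)]
@[simp] theorem gcomm_u : (gcomm x y).u q = x.α q.1.1 * y.α q.1.2 + x.α q.1.2 * y.α q.1.1 := by
  simp [gcomm]; grind
@[simp] theorem gcomm_v : (gcomm x y).v q = x.β q.1.1 * y.β q.1.2 + x.β q.1.2 * y.β q.1.1 := by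
  simp [gcomm]; grind
@[simp] theorem gcomm_p : (gcomm x y).p q = x.α q.1.1 * y.β q.1.2 + x.α q.1.2 * y.β q.1.1 +
    x.β q.1.1 * y.α q.1.2 + x.β q.1.2 * y.α q.1.1 := by
  simp [gcomm]; grind
@[simp] theorem gcomm_z : (gcomm x y).z w =
    x.α w.fst * y.p w.pair23 + x.α w.snd * y.p w.pair13 + x.α w.trd * y.p w.pair12 +
    y.α w.fst * x.p w.pair23 + y.α w.snd * x.p w.pair13 + y.α w.trd * x.p w.pair12 +
    x.α w.fst * x.α w.snd * y.β w.trd + x.α w.fst * x.α w.trd * y.β w.snd +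
    x.α w.snd * x.α w.trd * y.β w.fst + y.α w.fst * y.α w.snd * x.β w.trd +
    y.α w.fst * y.α w.trd * x.β w.snd + y.α w.snd * y.α w.trd * x.β w.fst := by
  simp [gcomm]; grind
@[simp] theorem gcomm_t : (gcomm x y).t w =
    x.β w.fst * y.p w.pair23 + x.β w.snd * y.p w.pair13 + x.β w.trd * y.p w.pair12 +
    y.β w.fst * x.p w.pair23 + y.β w.snd * x.p w.pair13 + y.β w.trd * x.p w.pair12 +
    x.α w.fst * (x.β w.snd * y.β w.trd + x.β w.trd * y.β w.snd + y.β w.snd * y.β w.trd) +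
    x.α w.snd * (x.β w.fst * y.β w.trd + x.β w.trd * y.β w.fst + y.β w.fst * y.β w.trd) +
    x.α w.trd * (x.β w.fst * y.β w.snd + x.β w.snd * y.β w.fst + y.β w.fst * y.β w.snd) +
    y.α w.fst * (x.β w.snd * x.β w.trd + x.β w.snd * y.β w.trd + x.β w.trd * y.β w.snd) +
    y.α w.snd * (x.β w.fst * x.β w.trd + x.β w.fst * y.β w.trd + x.β w.trd * y.β w.fst) +
    y.α w.trd * (x.β w.fst * x.β w.snd + x.β w.fst * y.β w.snd + x.β w.snd * y.β w.fst) := by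
  simp [gcomm]; grind

end Commutator

/-- Every monomial in the commutator formulas contains an `α`-, `β`- or `p`-coordinate of the first
argument. -/
theorem gcomm_eq_one_of_central {x : TrialityModel n} (hα : ∀ i, x.α i = 0)
    (hβ : ∀ i, x.β i = 0) (hp : ∀ q, x.p q = 0) (y : TrialityModel n) : gcomm x y = 1 := by
  ext q <;> simp [hα, hβ, hp]

section Generators

variable (i j k : Fin n) (l : Fin n) (q : IndexPair n) (w : IndexTriple n)

@[simp] theorem a_α : (a i).α = Pi.single i 1 := rfl
@[simp] theorem a_β : (a i).β l = 0 := rfl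
@[simp] theorem a_s : (a i).s l = 0 := rfl
@[simp] theorem a_r : (a i).r l = 0 := rfl
@[simp] theorem a_u : (a i).u q = 0 := rfl
@[simp] theorem a_v : (a i).v q = 0 := rfl
@[simp] theorem a_p : (a i).p q = 0 := rfl
@[simp] theorem a_z : (a i).z w = 0 := rfl
@[simp] theorem a_t : (a i).t w = 0 := rfl
@[simp] theorem b_α : (b i).α l = 0 := rfl
@[simp] theorem b_β : (b i).β = Pi.single i 1 := rfl
@[simp] theorem b_s : (b i).s l = 0 := rfl
@[simp] theorem b_r : (b i).r l = 0 := rfl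
@[simp] theorem b_u : (b i).u q = 0 := rfl
@[simp] theorem b_v : (b i).v q = 0 := rfl
@[simp] theorem b_p : (b i).p q = 0 := rfl
@[simp] theorem b_z : (b i).z w = 0 := rfl
@[simp] theorem b_t : (b i).t w = 0 := rfl

theorem single_mul_single_eq_zero {i j k : Fin n} (h : j ≠ k) :
    (Pi.single i 1 : Fin n → ZMod 2) j * (Pi.single i 1 : Fin n → ZMod 2) k = 0 :=
  mul_eq_zero.mpr (single_eq_zero_or_of_ne h)

theorem gcomm_a_b : gcomm (a i) (b j) =
    ⟨0, 0, 0, 0, 0, 0, fun q => (Pi.single i 1 : Fin n → ZMod 2) q.1.1 *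
      (Pi.single j 1 : Fin n → ZMod 2) q.1.2 + (Pi.single i 1 : Fin n → ZMod 2) q.1.2 *
      (Pi.single j 1 : Fin n → ZMod 2) q.1.1, 0, 0⟩ := by
  ext q <;> simp
  · simp only [single_mul_single_eq_zero q.2.1.ne, single_mul_single_eq_zero q.2.2.ne,
      single_mul_single_eq_zero (q.2.1.trans q.2.2).ne, zero_mul, add_zero]
  · simp only [single_mul_single_eq_zero q.2.1.ne, single_mul_single_eq_zero q.2.2.ne,
      single_mul_single_eq_zero (q.2.1.trans q.2.2).ne, mul_zero, add_zero]

theorem gcomm_a_b_comm : gcomm (a i) (b j) = gcomm (a j) (b i) := by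
  rw [gcomm_a_b, gcomm_a_b]
  ext q <;> simp
  ring

theorem gcomm_a_a_comm : gcomm (a i) (a j) = gcomm (a j) (a i) := by
  ext q <;> simp
  ring

theorem gcomm_b_b_comm : gcomm (b i) (b j) = gcomm (b j) (b i) := by
  ext q <;> simp
  ring

/-- The only coordinate that can be nonzero is `z`, and there it is the sum over all permutations
matching `i, j, k` with the three indices of the triple; hence it is symmetric in `i, j, k`. -/
theorem gcomm_gcomm_a : gcomm (gcomm (a i) (b j)) (a k) =
    gcomm (gcomm (a k) (b i)) (a j) := by
  ext q <;> simp [gcomm_a_b]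
  ring

theorem gcomm_gcomm_b : gcomm (gcomm (a i) (b j)) (b k) =
    gcomm (gcomm (a k) (b i)) (b j) := by
  ext q <;> simp [gcomm_a_b]
  ring

theorem sq_eq_one {x : TrialityModel n} (hα : ∀ i, x.α i = 0) (hβ : ∀ i, x.β i = 0) :
    x ^ 2 = 1 := by
  rw [pow_two]
  ext q <;> simp [hα, hβ] <;> grind

theorem lift_eq_of_isRelation {x y : TrialityGroup.Words n}
    (h : TrialityGroup.IsRelation x y) :
    FreeGroup.lift (Sum.elim a b) x = FreeGroup.lift (Sum.elim a b) y := by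
  have hc (x y : TrialityGroup.Words n) : FreeGroup.lift (Sum.elim a b) (gcomm x y) =
      gcomm (FreeGroup.lift (Sum.elim a b) x) (FreeGroup.lift (Sum.elim a b) y) := by
    simp [gcomm]
  have ha (i : Fin n) : FreeGroup.lift (Sum.elim a b) (TrialityGroup.wa i) = a i := by
    simp [TrialityGroup.wa]
  have hb (i : Fin n) : FreeGroup.lift (Sum.elim a b) (TrialityGroup.wb i) = b i := by
    simp [TrialityGroup.wb]
  have hsqa (i : Fin n) (y : TrialityModel n) : gcomm (a i ^ 2) y = 1 := by
    rw [pow_two]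
    exact gcomm_eq_one_of_central (by simp [CharTwo.add_self_eq_zero]) (by simp) (by simp) y
  have hsqb (i : Fin n) (y : TrialityModel n) : gcomm (b i ^ 2) y = 1 := by
    rw [pow_two]
    exact gcomm_eq_one_of_central (by simp) (by simp [CharTwo.add_self_eq_zero]) (by simp) y
  have hz (x y z w : TrialityModel n) : gcomm (gcomm (gcomm x y) z) w = 1 :=
    gcomm_eq_one_of_central (by simp) (by simp) (by simp) w
  have h4 (x : TrialityModel n) : x ^ 4 = 1 := by
    rw [show 4 = 2 * 2 from rfl, pow_mul]
    refine sq_eq_one ?_ ?_ <;> intro q <;> simp [pow_two] <;> grind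
  cases h with
  | comm_a_b i =>
    rw [hc, ha, hb, gcomm_a_b, map_one]
    ext q <;> simp
    -- With equal indices the two terms of the `p`-coordinate coincide, and `2 = 0` holds by `rfl`
    -- in `ZMod 2`.
    rw [mul_comm, ← two_mul]
    exact mul_eq_zero_of_left rfl _
  | a_sq_central i g => rw [hc, map_pow, map_one, ha, hsqa]
  | b_sq_central i g => rw [hc, map_pow, map_one, hb, hsqb]
  | u_symm i j h => simp only [TrialityGroup.wu, hc, ha, gcomm_a_a_comm i j]
  | v_symm i j h => simp only [TrialityGroup.wv, hc, hb, gcomm_b_b_comm i j]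
  | u_sq i j h =>
    rw [map_pow, TrialityGroup.wu, hc, map_one, sq_eq_one (by simp) (by simp)]
  | v_sq i j h =>
    rw [map_pow, TrialityGroup.wv, hc, map_one, sq_eq_one (by simp) (by simp)]
  | u_central i j g h =>
    rw [hc, TrialityGroup.wu, hc, ha, ha, map_one]
    exact gcomm_eq_one_of_central (by simp) (by simp) (by simp) _
  | v_central i j g h =>
    rw [hc, TrialityGroup.wv, hc, hb, hb, map_one]
    exact gcomm_eq_one_of_central (by simp) (by simp) (by simp) _
  | p_symm i j h => simp only [TrialityGroup.wp, hc, ha, hb, gcomm_a_b_comm i j]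
  | p_sq i j h =>
    rw [map_pow, TrialityGroup.wp, hc, map_one, sq_eq_one (by simp) (by simp)]
  | z_swap i j k h =>
    simp only [TrialityGroup.wz, TrialityGroup.wp, hc, ha, hb, gcomm_a_b_comm i j]
  | z_cycle i j k h =>
    simp only [TrialityGroup.wz, TrialityGroup.wp, hc, ha, hb, gcomm_a_b_comm j i,
      gcomm_gcomm_a i j k]
  | t_swap i j k h =>
    simp only [TrialityGroup.wt, TrialityGroup.wp, hc, ha, hb, gcomm_a_b_comm i j]
  | t_cycle i j k h =>
    simp only [TrialityGroup.wt, TrialityGroup.wp, hc, ha, hb, gcomm_a_b_comm j i,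
      gcomm_gcomm_b i j k]
  | t_sq i j k h =>
    rw [map_pow, TrialityGroup.wt, hc, map_one, sq_eq_one (by simp) (by simp)]
  | z_sq i j k h =>
    rw [map_pow, TrialityGroup.wz, hc, map_one, sq_eq_one (by simp) (by simp)]
  | z_central i j k g h => rw [hc, TrialityGroup.wz, hc, TrialityGroup.wp, hc, hz, map_one]
  | t_central i j k g h => rw [hc, TrialityGroup.wt, hc, TrialityGroup.wp, hc, hz, map_one]
  | a_pow_four i => rw [map_pow, h4, map_one]
  | b_pow_four i => rw [map_pow, h4, map_one]

end Generators

end TrialityModel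

/-- The homomorphism from `G_n` onto its model. -/
def TrialityGroup.toModel (n : ℕ) : TrialityGroup n →* TrialityModel n :=
  PresentedGroup.toGroup (f := Sum.elim TrialityModel.a TrialityModel.b) (by
    rintro r ⟨x, y, h, rfl⟩
    rw [map_mul, map_inv, TrialityModel.lift_eq_of_isRelation h, mul_inv_cancel])

namespace TrialityGroup

variable {n : ℕ}

@[simp] theorem toModel_a (i : Fin n) : toModel n (a i) = TrialityModel.a i :=
  PresentedGroup.toGroup.of _

@[simp] theorem toModel_b (i : Fin n) : toModel n (b i) = TrialityModel.b i :=
  PresentedGroup.toGroup.of _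

end TrialityGroup

/-! ### The order of `G_n` -/

section CardBounds

/-- Commuting involutions define a homomorphism from `(Z/2)^ι` whose range contains them.
Independence is not needed for an upper bound. -/
theorem card_closure_range_le {G ι : Type*} [Group G] [Finite ι] (f : ι → G)
    (hc : ∀ i j, Commute (f i) (f j)) (hs : ∀ i, f i * f i = 1) :
    Finite (Subgroup.closure (Set.range f)) ∧
      Nat.card (Subgroup.closure (Set.range f)) ≤ 2 ^ Nat.card ι := by
  have := Fintype.ofFinite ι
  let φ (i : ι) : Multiplicative (ZMod 2) →* G :=
    AddMonoidHom.toMultiplicativeLeft (ZMod.lift 2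
      ⟨zmultiplesHom (Additive G) (Additive.ofMul (f i)), by
        simpa [two_zsmul] using congrArg Additive.ofMul (hs i)⟩)
  have hφ1 (i : ι) : φ i (Multiplicative.ofAdd 1) = f i := by
    have h := ZMod.lift_coe 2 (⟨zmultiplesHom (Additive G) (Additive.ofMul (f i)), by
      simpa [two_zsmul] using congrArg Additive.ofMul (hs i)⟩ :
        {g : ℤ →+ Additive G // g (2 : ℕ) = 0}) 1
    rw [Int.cast_one] at h
    exact (congrArg Additive.toMul h).trans (by simp)
  have hφ (i : ι) (x : Multiplicative (ZMod 2)) : φ i x = 1 ∨ φ i x = f i := by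
    have hx : ∀ x : Multiplicative (ZMod 2), x = 1 ∨ x = Multiplicative.ofAdd 1 := by decide
    rcases hx x with rfl | rfl
    · exact Or.inl (map_one _)
    · exact Or.inr (hφ1 i)
  have hcomm : Pairwise fun i j => ∀ x y, Commute (φ i x) (φ j y) := by
    intro i j _ x y
    rcases hφ i x with h | h <;> rcases hφ j y with h' | h' <;> rw [h, h'] <;> simp [hc]
  have hle : Subgroup.closure (Set.range f) ≤ (MonoidHom.noncommPiCoprod φ hcomm).range := by
    rw [Subgroup.closure_le, MonoidHom.noncommPiCoprod_range]
    rintro _ ⟨i, rfl⟩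
    exact Subgroup.mem_iSup_of_mem i ⟨_, hφ1 i⟩
  have hfin : Finite (MonoidHom.noncommPiCoprod φ hcomm).range :=
    Finite.of_surjective _ (MonoidHom.noncommPiCoprod φ hcomm).rangeRestrict_surjective
  refine ⟨Finite.of_injective _ (Subgroup.inclusion_injective hle), ?_⟩
  refine (Nat.card_le_card_of_injective _ (Subgroup.inclusion_injective hle)).trans ?_
  refine (Nat.card_le_card_of_surjective _
    (MonoidHom.noncommPiCoprod φ hcomm).rangeRestrict_surjective).trans ?_
  rw [Nat.card_fun]
  simp

/-- Lagrange for the central subgroup generated by the `f i`. The hypothesis ranges over all normal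
`N` containing the `f i`, so that applications use only this membership and the argument can be
iterated. -/
theorem finite_and_card_le_of_central_involutions {G ι : Type*} [Group G] [Finite ι] (f : ι → G)
    (hc : ∀ i, f i ∈ Subgroup.center G) (hs : ∀ i, f i * f i = 1) (k : ℕ)
    (h : ∀ N : Subgroup G, ∀ _ : N.Normal, (∀ i, f i ∈ N) →
      Finite (G ⧸ N) ∧ Nat.card (G ⧸ N) ≤ 2 ^ k) :
    Finite G ∧ Nat.card G ≤ 2 ^ (Nat.card ι + k) := by
  obtain ⟨hf, hcard⟩ := card_closure_range_le f
    (fun i j => ((Subgroup.mem_center_iff.mp (hc i)) (f j)).symm) hs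
  set N := Subgroup.closure (Set.range f) with hN
  have hle : N ≤ Subgroup.center G := by
    rw [hN, Subgroup.closure_le]
    rintro _ ⟨i, rfl⟩
    exact hc i
  have hnormal : N.Normal := by
    refine ⟨fun x hx g => ?_⟩
    rw [Subgroup.mem_center_iff.mp (hle hx) g, mul_inv_cancel_right]
    exact hx
  obtain ⟨hq, hqcard⟩ := h N hnormal fun i => Subgroup.subset_closure ⟨i, rfl⟩
  have hG := Subgroup.card_eq_card_quotient_mul_card_subgroup N
  refine ⟨Nat.finite_of_card_ne_zero ?_, ?_⟩
  · rw [hG]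
    exact Nat.mul_ne_zero Nat.card_pos.ne' Nat.card_pos.ne'
  · rw [hG, pow_add, mul_comm]
    exact Nat.mul_le_mul hcard hqcard

theorem mem_center_of_closure_eq_top {G : Type*} [Group G] {S : Set G}
    (hS : Subgroup.closure S = ⊤) {x : G} (h : ∀ s ∈ S, Commute x s) :
    x ∈ Subgroup.center G := by
  have h1 : Subgroup.closure S ≤ Subgroup.centralizer {x} := by
    rw [Subgroup.closure_le]
    intro s hs
    rw [SetLike.mem_coe, Subgroup.mem_centralizer_singleton_iff]
    exact (h s hs).symm
  rw [Subgroup.mem_center_iff]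
  intro g
  have h2 : g ∈ Subgroup.centralizer {x} := h1 (hS ▸ Subgroup.mem_top g)
  exact Subgroup.mem_centralizer_singleton_iff.mp h2

theorem closure_range_comp_eq_top {G H ι : Type*} [Group G] [Group H] {f : ι → G}
    (hf : Subgroup.closure (Set.range f) = ⊤) (φ : G →* H) (hφ : Function.Surjective φ) :
    Subgroup.closure (Set.range fun i => φ (f i)) = ⊤ := by
  have h := congrArg (Subgroup.map φ) hf
  rwa [MonoidHom.map_closure, Subgroup.map_top_of_surjective φ hφ, ← Set.range_comp] at h

end CardBounds

/-! ### Commutators with a central square. -/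

section GroupCommutator

variable {G : Type*} [Group G]

theorem gcomm_eq_one_iff_commute {x y : G} : gcomm x y = 1 ↔ Commute x y := by
  rw [gcomm, mul_assoc, ← mul_inv_rev, inv_mul_eq_one, commute_iff_eq, eq_comm]

theorem commute_map_of_gcomm_eq_one {H : Type*} [Group H] (φ : G →* H) {x y : G}
    (h : φ (gcomm x y) = 1) : Commute (φ x) (φ y) := by
  rw [← gcomm_eq_one_iff_commute, ← h]
  simp [gcomm]

/-- Write `c = [x, y]`, so that `y⁻¹ x y = x c`. Squaring gives `(x c)² = y⁻¹ x² y = x²`, that is `c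
x c = x`, and `c = c⁻¹` finishes. This is what makes `p_ij` commute with letters carrying the index
`i` or `j`, about which the relations on `z` and `t` say nothing. -/
theorem commute_gcomm_left {x y : G} (h : Commute (x ^ 2) y) (hp : gcomm x y ^ 2 = 1) :
    Commute (gcomm x y) x := by
  have h1 : y⁻¹ * x * y = x * gcomm x y := by simp [gcomm, mul_assoc]
  have h2 : (x * gcomm x y) * (x * gcomm x y) = x * x := by
    rw [← h1, show y⁻¹ * x * y * (y⁻¹ * x * y) = y⁻¹ * (x ^ 2 * y) by simp [pow_two, mul_assoc],
      h.eq, pow_two, inv_mul_cancel_left]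
  have h3 : gcomm x y * x * gcomm x y = x := by simpa [mul_assoc] using h2
  have h4 : (gcomm x y)⁻¹ = gcomm x y := by rw [inv_eq_iff_mul_eq_one, ← pow_two, hp]
  rw [commute_iff_eq]
  calc gcomm x y * x = gcomm x y * x * gcomm x y * (gcomm x y)⁻¹ := by simp
    _ = x * gcomm x y := by rw [h3, h4]

theorem commute_gcomm_right {x y : G} (h : Commute (y ^ 2) x) (hp : gcomm x y ^ 2 = 1) :
    Commute (gcomm x y) y := by
  have h4 : gcomm y x = (gcomm x y)⁻¹ := by simp [gcomm, mul_assoc]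
  have h5 := commute_gcomm_left h (by rw [h4, inv_pow, hp, inv_one])
  rw [h4] at h5
  exact Commute.inv_left_iff.mp h5

end GroupCommutator

/-! ### The upper bound for the order of `G_n`. -/

namespace TrialityGroup

variable {n : ℕ}

theorem mk_eq_of_isRelation {x y : Words n} (h : IsRelation x y) :
    (PresentedGroup.mk _ x : TrialityGroup n) = PresentedGroup.mk _ y := by
  have h1 : (PresentedGroup.mk _ (x * y⁻¹) : TrialityGroup n) = 1 :=
    (QuotientGroup.eq_one_iff _).mpr (Subgroup.subset_normalClosure ⟨x, y, h, rfl⟩)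
  rwa [map_mul, map_inv, mul_inv_eq_one] at h1

theorem mk_mem_center_of_isRelation {x : Words n} (h : ∀ w, IsRelation (gcomm x w) 1) :
    (PresentedGroup.mk _ x : TrialityGroup n) ∈ Subgroup.center _ := by
  rw [Subgroup.mem_center_iff]
  intro g
  obtain ⟨w, rfl⟩ := PresentedGroup.mk_surjective _ g
  exact (commute_map_of_gcomm_eq_one (PresentedGroup.mk _)
    ((mk_eq_of_isRelation (h w)).trans (map_one _))).symm

theorem closure_range_generators :
    Subgroup.closure (Set.range (Sum.elim a b : Fin n ⊕ Fin n → TrialityGroup n)) = ⊤ := by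
  have : (Sum.elim a b : Fin n ⊕ Fin n → TrialityGroup n) = PresentedGroup.of := by
    ext (i | i) <;> rfl
  rw [this]
  exact PresentedGroup.closure_range_of _

theorem gcomm_a_b_self (i : Fin n) : gcomm (a i) (b i : TrialityGroup n) = 1 :=
  mk_eq_of_isRelation (IsRelation.comm_a_b i)

theorem a_sq_mem_center (i : Fin n) : (a i : TrialityGroup n) ^ 2 ∈ Subgroup.center _ :=
  mk_mem_center_of_isRelation fun w => IsRelation.a_sq_central i w

theorem b_sq_mem_center (i : Fin n) : (b i : TrialityGroup n) ^ 2 ∈ Subgroup.center _ :=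
  mk_mem_center_of_isRelation fun w => IsRelation.b_sq_central i w

theorem a_pow_four (i : Fin n) : (a i : TrialityGroup n) ^ 4 = 1 :=
  mk_eq_of_isRelation (IsRelation.a_pow_four i)

theorem b_pow_four (i : Fin n) : (b i : TrialityGroup n) ^ 4 = 1 :=
  mk_eq_of_isRelation (IsRelation.b_pow_four i)

theorem gcomm_a_a_mem_center {i j : Fin n} (h : i < j) :
    gcomm (a i) (a j : TrialityGroup n) ∈ Subgroup.center _ :=
  mk_mem_center_of_isRelation fun w => IsRelation.u_central i j w h

theorem gcomm_b_b_mem_center {i j : Fin n} (h : i < j) :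
    gcomm (b i) (b j : TrialityGroup n) ∈ Subgroup.center _ :=
  mk_mem_center_of_isRelation fun w => IsRelation.v_central i j w h

theorem gcomm_a_a_sq {i j : Fin n} (h : i < j) : gcomm (a i) (a j : TrialityGroup n) ^ 2 = 1 :=
  mk_eq_of_isRelation (IsRelation.u_sq i j h)

theorem gcomm_b_b_sq {i j : Fin n} (h : i < j) : gcomm (b i) (b j : TrialityGroup n) ^ 2 = 1 :=
  mk_eq_of_isRelation (IsRelation.v_sq i j h)

theorem gcomm_a_b_sq {i j : Fin n} (h : i < j) : gcomm (a i) (b j : TrialityGroup n) ^ 2 = 1 :=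
  mk_eq_of_isRelation (IsRelation.p_sq i j h)

theorem gcomm_a_b_symm {i j : Fin n} (h : i < j) :
    gcomm (a i) (b j : TrialityGroup n) = gcomm (a j) (b i) :=
  mk_eq_of_isRelation (IsRelation.p_symm i j h)

/-- The element `z_ijk` of `G_n`. -/
def zElt (i j k : Fin n) : TrialityGroup n := gcomm (gcomm (a i) (b j)) (a k)

/-- The element `t_ijk` of `G_n`. -/
def tElt (i j k : Fin n) : TrialityGroup n := gcomm (gcomm (a i) (b j)) (b k)

theorem zElt_mem_center {i j k : Fin n} (h : Distinct i j k) :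
    zElt i j k ∈ Subgroup.center (TrialityGroup n) :=
  mk_mem_center_of_isRelation fun w => IsRelation.z_central i j k w h

theorem tElt_mem_center {i j k : Fin n} (h : Distinct i j k) :
    tElt i j k ∈ Subgroup.center (TrialityGroup n) :=
  mk_mem_center_of_isRelation fun w => IsRelation.t_central i j k w h

theorem zElt_sq {i j k : Fin n} (h : Distinct i j k) : zElt i j k ^ 2 = 1 :=
  mk_eq_of_isRelation (IsRelation.z_sq i j k h)

theorem tElt_sq {i j k : Fin n} (h : Distinct i j k) : tElt i j k ^ 2 = 1 :=
  mk_eq_of_isRelation (IsRelation.t_sq i j k h)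

theorem zElt_swap {i j k : Fin n} (h : Distinct i j k) : zElt i j k = zElt j i k :=
  mk_eq_of_isRelation (IsRelation.z_swap i j k h)

theorem zElt_cycle {i j k : Fin n} (h : Distinct i j k) : zElt i j k = zElt k i j :=
  (zElt_swap h).trans (mk_eq_of_isRelation (IsRelation.z_cycle i j k h))

theorem tElt_swap {i j k : Fin n} (h : Distinct i j k) : tElt i j k = tElt j i k :=
  mk_eq_of_isRelation (IsRelation.t_swap i j k h)

theorem tElt_cycle {i j k : Fin n} (h : Distinct i j k) : tElt i j k = tElt k i j :=
  (tElt_swap h).trans (mk_eq_of_isRelation (IsRelation.t_cycle i j k h))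

theorem distinct_of_lt {i j k : Fin n} (h : i < j) (h' : j < k) : Distinct i j k :=
  ⟨h.ne, (h.trans h').ne, h'.ne⟩

/-- The central generators `a_i²`, `b_i²`, `u_ij`, `v_ij`, `z_ijk`, `t_ijk` of `G_n`. -/
def centralElt : (Fin n ⊕ Fin n) ⊕ (IndexPair n ⊕ IndexPair n) ⊕ (IndexTriple n ⊕ IndexTriple n) →
    TrialityGroup n
  | .inl (.inl i) => a i ^ 2
  | .inl (.inr i) => b i ^ 2
  | .inr (.inl (.inl q)) => gcomm (a q.1.1) (a q.1.2)
  | .inr (.inl (.inr q)) => gcomm (b q.1.1) (b q.1.2)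
  | .inr (.inr (.inl q)) => zElt q.fst q.snd q.trd
  | .inr (.inr (.inr q)) => tElt q.fst q.snd q.trd

theorem centralElt_mem_center (x) : (centralElt x : TrialityGroup n) ∈ Subgroup.center _ :=
  match x with
  | .inl (.inl i) => a_sq_mem_center i
  | .inl (.inr i) => b_sq_mem_center i
  | .inr (.inl (.inl q)) => gcomm_a_a_mem_center q.2
  | .inr (.inl (.inr q)) => gcomm_b_b_mem_center q.2
  | .inr (.inr (.inl q)) => zElt_mem_center (distinct_of_lt q.2.1 q.2.2)
  | .inr (.inr (.inr q)) => tElt_mem_center (distinct_of_lt q.2.1 q.2.2)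

theorem centralElt_mul_self (x) : (centralElt x : TrialityGroup n) * centralElt x = 1 := by
  rw [← pow_two]
  exact match x with
  | .inl (.inl i) => (pow_mul _ _ _).symm.trans (a_pow_four i)
  | .inl (.inr i) => (pow_mul _ _ _).symm.trans (b_pow_four i)
  | .inr (.inl (.inl q)) => gcomm_a_a_sq q.2
  | .inr (.inl (.inr q)) => gcomm_b_b_sq q.2
  | .inr (.inr (.inl q)) => zElt_sq (distinct_of_lt q.2.1 q.2.2)
  | .inr (.inr (.inr q)) => tElt_sq (distinct_of_lt q.2.1 q.2.2)

section Quotient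

variable {N : Subgroup (TrialityGroup n)} (hN : ∀ x, centralElt x ∈ N)
include hN

/-- If `k` differs from `i` and `j`, the symmetries of `z` sort the three indices, and `N` contains
the sorted element. If `k` is repeated, the commutator is trivial by `commute_gcomm_left`. -/
theorem gcomm_gcomm_a_mem {i j : Fin n} (h : i < j) (k : Fin n) :
    gcomm (gcomm (a i) (b j)) (a k) ∈ N := by
  have hz {i j k : Fin n} (h : i < j) (h' : j < k) : zElt i j k ∈ N :=
    hN (.inr (.inr (.inl ⟨(i, j, k), h, h'⟩)))
  have hc (i j : Fin n) : Commute ((a i : TrialityGroup n) ^ 2) (b j) :=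
    (Subgroup.mem_center_iff.mp (a_sq_mem_center i) _).symm
  rcases lt_trichotomy k i with hk | rfl | hk
  · have := hz hk h
    rwa [← zElt_cycle ⟨h.ne, hk.ne', (hk.trans h).ne'⟩] at this
  · rw [gcomm_eq_one_iff_commute.mpr (commute_gcomm_left (hc _ _) (gcomm_a_b_sq h))]
    exact N.one_mem
  · rcases lt_trichotomy k j with hk' | rfl | hk'
    · have := hz hk hk'
      rwa [zElt_swap (distinct_of_lt hk hk'), ← zElt_cycle ⟨h.ne, hk.ne, hk'.ne'⟩] at this
    -- For `k = j` the symmetry `p_ij = p_ji` brings `a_j` into the first slot.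
    · have hp := gcomm_a_b_sq h
      rw [gcomm_a_b_symm h] at hp ⊢
      rw [gcomm_eq_one_iff_commute.mpr (commute_gcomm_left (hc _ _) hp)]
      exact N.one_mem
    · exact hz h hk'

theorem gcomm_gcomm_b_mem {i j : Fin n} (h : i < j) (k : Fin n) :
    gcomm (gcomm (a i) (b j)) (b k) ∈ N := by
  have hz {i j k : Fin n} (h : i < j) (h' : j < k) : tElt i j k ∈ N :=
    hN (.inr (.inr (.inr ⟨(i, j, k), h, h'⟩)))
  have hc (i j : Fin n) : Commute ((b i : TrialityGroup n) ^ 2) (a j) :=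
    (Subgroup.mem_center_iff.mp (b_sq_mem_center i) _).symm
  rcases lt_trichotomy k i with hk | rfl | hk
  · have := hz hk h
    rwa [← tElt_cycle ⟨h.ne, hk.ne', (hk.trans h).ne'⟩] at this
  · have hp := gcomm_a_b_sq h
    rw [gcomm_a_b_symm h] at hp ⊢
    rw [gcomm_eq_one_iff_commute.mpr (commute_gcomm_right (hc _ _) hp)]
    exact N.one_mem
  · rcases lt_trichotomy k j with hk' | rfl | hk'
    · have := hz hk hk'
      rwa [tElt_swap (distinct_of_lt hk hk'), ← tElt_cycle ⟨h.ne, hk.ne, hk'.ne'⟩] at this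
    · rw [gcomm_eq_one_iff_commute.mpr (commute_gcomm_right (hc _ _) (gcomm_a_b_sq h))]
      exact N.one_mem
    · exact hz h hk'

end Quotient

theorem finite_and_card_le (n : ℕ) : Finite (TrialityGroup n) ∧
    Nat.card (TrialityGroup n) ≤ 2 ^ (4 * n + (3 * n.choose 2 + 2 * n.choose 3)) := by
  have key := finite_and_card_le_of_central_involutions (centralElt (n := n))
    -- The central layer contributes the exponent `2n + 2 (n choose 2) + 2 (n choose 3)`. The
    -- quotient is left with the `p_ij`, now central, and above them `2n` commuting involutions, the
    -- images of the letters.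
    centralElt_mem_center centralElt_mul_self (n.choose 2 + 2 * n) (fun N _ hN => by
    have hgen := closure_range_comp_eq_top (closure_range_generators (n := n))
      (QuotientGroup.mk' N) (QuotientGroup.mk'_surjective N)
    have h2 := finite_and_card_le_of_central_involutions
      (fun q : IndexPair n => QuotientGroup.mk' N (gcomm (a q.1.1) (b q.1.2)))
      (fun q => mem_center_of_closure_eq_top hgen (by
        rintro _ ⟨i | i, rfl⟩
        · exact commute_map_of_gcomm_eq_one _
            ((QuotientGroup.eq_one_iff _).mpr (gcomm_gcomm_a_mem hN q.2 i))
        · exact commute_map_of_gcomm_eq_one _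
            ((QuotientGroup.eq_one_iff _).mpr (gcomm_gcomm_b_mem hN q.2 i))))
      (fun q => by rw [← pow_two, ← map_pow, gcomm_a_b_sq q.2, map_one]) (2 * n)
      (fun P _ hP => by
        have hgen2 := closure_range_comp_eq_top hgen
          (QuotientGroup.mk' P) (QuotientGroup.mk'_surjective P)
        let φ := (QuotientGroup.mk' P).comp (QuotientGroup.mk' N)
        have hφ (x) : φ (centralElt x) = 1 := by
          have h1 : QuotientGroup.mk' N (centralElt x) = 1 := (QuotientGroup.eq_one_iff _).mpr (hN x)
          rw [MonoidHom.comp_apply, h1, map_one]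
        have haa {i j : Fin n} (h : i < j) : Commute (φ (a i)) (φ (a j)) :=
          commute_map_of_gcomm_eq_one φ (hφ (.inr (.inl (.inl ⟨(i, j), h⟩))))
        have hbb {i j : Fin n} (h : i < j) : Commute (φ (b i)) (φ (b j)) :=
          commute_map_of_gcomm_eq_one φ (hφ (.inr (.inl (.inr ⟨(i, j), h⟩))))
        have hab (i j : Fin n) : Commute (φ (a i)) (φ (b j)) := by
          apply commute_map_of_gcomm_eq_one φ
          rcases lt_trichotomy i j with h | rfl | h
          · exact (QuotientGroup.eq_one_iff _).mpr (hP ⟨(i, j), h⟩)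
          · rw [gcomm_a_b_self, map_one]
          · rw [← gcomm_a_b_symm h]
            exact (QuotientGroup.eq_one_iff _).mpr (hP ⟨(j, i), h⟩)
        have haa' (i j : Fin n) : Commute (φ (a i)) (φ (a j)) := by
          rcases lt_trichotomy i j with h | rfl | h
          · exact haa h
          · exact Commute.refl _
          · exact (haa h).symm
        have hbb' (i j : Fin n) : Commute (φ (b i)) (φ (b j)) := by
          rcases lt_trichotomy i j with h | rfl | h
          · exact hbb h
          · exact Commute.refl _
          · exact (hbb h).symm
        have h3 := card_closure_range_le (fun x => φ (Sum.elim a b x)) (by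
            rintro (i | i) (j | j)
            · exact haa' i j
            · exact hab i j
            · exact (hab j i).symm
            · exact hbb' i j) (by
            rintro (i | i)
            · rw [← map_mul, Sum.elim_inl, ← pow_two]
              exact hφ (.inl (.inl i))
            · rw [← map_mul, Sum.elim_inr, ← pow_two]
              exact hφ (.inl (.inr i)))
        have h4 : Subgroup.closure (Set.range fun x => φ (Sum.elim a b x)) = ⊤ := hgen2
        rw [h4] at h3
        obtain ⟨h5, h6⟩ := h3
        refine ⟨Finite.of_equiv _ Subgroup.topEquiv.toEquiv, ?_⟩
        rw [← Nat.card_congr Subgroup.topEquiv.toEquiv]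
        refine h6.trans_eq ?_
        rw [Nat.card_sum, Nat.card_fin, two_mul])
    rwa [card_indexPair] at h2)
  refine ⟨key.1, key.2.trans_eq ?_⟩
  simp only [Nat.card_sum, card_indexPair, card_indexTriple, Nat.card_fin]
  congr 1
  ring

end TrialityGroup

/-! ### `G_n` is isomorphic to its model -/

theorem Pi.zmod_two_induction {ι : Type*} [Finite ι] [DecidableEq ι] {p : (ι → ZMod 2) → Prop}
    (zero : p 0) (single : ∀ i, p (Pi.single i 1)) (add : ∀ f g, p f → p g → p (f + g))
    (f : ι → ZMod 2) : p f := by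
  refine Pi.single_induction p f zero add fun i m => ?_
  have hm : ∀ m : ZMod 2, m = 0 ∨ m = 1 := by decide
  rcases hm m with rfl | rfl
  · rwa [Pi.single_zero]
  · exact single i

namespace TrialityModel

variable {n : ℕ}

theorem single_pair_apply (q w : IndexPair n) :
    (Pi.single q.1.1 1 : Fin n → ZMod 2) w.1.1 * (Pi.single q.1.2 1 : Fin n → ZMod 2) w.1.2 +
      (Pi.single q.1.1 1 : Fin n → ZMod 2) w.1.2 * (Pi.single q.1.2 1 : Fin n → ZMod 2) w.1.1 =
      (Pi.single q 1 : IndexPair n → ZMod 2) w := by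
  obtain ⟨⟨i, j⟩, h⟩ := q
  obtain ⟨⟨k, l⟩, h'⟩ := w
  simp only [Pi.single_apply, Subtype.mk.injEq, Prod.mk.injEq]
  dsimp only at h h'
  grind

/-- Both triples increase, so among the possible matchings of their entries only the
order-preserving one survives. Thus `[p_ij, a_k]` and `[p_ij, b_k]` with `i < j < k` each have a
single nonzero coordinate. -/
theorem single_triple_apply (q w : IndexTriple n) :
    (Pi.single q.trd 1 : Fin n → ZMod 2) w.fst *
        (Pi.single (⟨(q.fst, q.snd), q.2.1⟩ : IndexPair n) 1 : IndexPair n → ZMod 2) w.pair23 +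
      (Pi.single q.trd 1 : Fin n → ZMod 2) w.snd *
        (Pi.single (⟨(q.fst, q.snd), q.2.1⟩ : IndexPair n) 1 : IndexPair n → ZMod 2) w.pair13 +
      (Pi.single q.trd 1 : Fin n → ZMod 2) w.trd *
        (Pi.single (⟨(q.fst, q.snd), q.2.1⟩ : IndexPair n) 1 : IndexPair n → ZMod 2) w.pair12 =
      (Pi.single q 1 : IndexTriple n → ZMod 2) w := by
  obtain ⟨⟨i, j, k⟩, h, h'⟩ := q
  obtain ⟨⟨i', j', k'⟩, h1, h1'⟩ := w
  simp only [Pi.single_apply, IndexTriple.pair12, IndexTriple.pair13, IndexTriple.pair23,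
    Subtype.mk.injEq, Prod.mk.injEq]
  dsimp only at h h' h1 h1'
  grind

/-- Each coordinate layer lies in `H`: squares of letters give `s` and `r`, commutators of letters
give `u`, `v`, `p`, and commutators of `p` with letters give `z` and `t`. The layers `α` and `β`
come last because they are not closed under multiplication. -/
theorem eq_top_of_generators_mem {H : Subgroup (TrialityModel n)} (ha : ∀ i, a i ∈ H)
    (hb : ∀ i, b i ∈ H) : H = ⊤ := by
  have hc {x y : TrialityModel n} (hx : x ∈ H) (hy : y ∈ H) : gcomm x y ∈ H :=
    H.mul_mem (H.mul_mem (H.mul_mem (H.inv_mem hx) (H.inv_mem hy)) hx) hy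
  have hs (f : Fin n → ZMod 2) : (⟨0, 0, f, 0, 0, 0, 0, 0, 0⟩ : TrialityModel n) ∈ H := by
    refine Pi.zmod_two_induction (p := fun f => ⟨0, 0, f, 0, 0, 0, 0, 0, 0⟩ ∈ H) H.one_mem
      (fun i => ?_) (fun f g hf hg => ?_) f
    · convert H.mul_mem (ha i) (ha i) using 1
      ext q <;> simp [CharTwo.add_self_eq_zero, ZMod.two_mul_self]
      exact single_eq_zero_or_of_ne q.2.ne'
    · convert H.mul_mem hf hg using 1
      ext q <;> simp
  have hr (f : Fin n → ZMod 2) : (⟨0, 0, 0, f, 0, 0, 0, 0, 0⟩ : TrialityModel n) ∈ H := by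
    refine Pi.zmod_two_induction (p := fun f => ⟨0, 0, 0, f, 0, 0, 0, 0, 0⟩ ∈ H) H.one_mem
      (fun i => ?_) (fun f g hf hg => ?_) f
    · convert H.mul_mem (hb i) (hb i) using 1
      ext q <;> simp [CharTwo.add_self_eq_zero, ZMod.two_mul_self]
      exact single_eq_zero_or_of_ne q.2.ne'
    · convert H.mul_mem hf hg using 1
      ext q <;> simp
  have hu (f : IndexPair n → ZMod 2) : (⟨0, 0, 0, 0, f, 0, 0, 0, 0⟩ : TrialityModel n) ∈ H := by
    refine Pi.zmod_two_induction (p := fun f => ⟨0, 0, 0, 0, f, 0, 0, 0, 0⟩ ∈ H) H.one_mem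
      (fun i => ?_) (fun f g hf hg => ?_) f
    · convert hc (ha i.1.1) (ha i.1.2) using 1
      ext q <;> simp [single_pair_apply]
    · convert H.mul_mem hf hg using 1
      ext q <;> simp
  have hv (f : IndexPair n → ZMod 2) : (⟨0, 0, 0, 0, 0, f, 0, 0, 0⟩ : TrialityModel n) ∈ H := by
    refine Pi.zmod_two_induction (p := fun f => ⟨0, 0, 0, 0, 0, f, 0, 0, 0⟩ ∈ H) H.one_mem
      (fun i => ?_) (fun f g hf hg => ?_) f
    · convert hc (hb i.1.1) (hb i.1.2) using 1
      ext q <;> simp [single_pair_apply]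
    · convert H.mul_mem hf hg using 1
      ext q <;> simp
  have hp (f : IndexPair n → ZMod 2) : (⟨0, 0, 0, 0, 0, 0, f, 0, 0⟩ : TrialityModel n) ∈ H := by
    refine Pi.zmod_two_induction (p := fun f => ⟨0, 0, 0, 0, 0, 0, f, 0, 0⟩ ∈ H) H.one_mem
      (fun i => ?_) (fun f g hf hg => ?_) f
    · convert hc (ha i.1.1) (hb i.1.2) using 1
      rw [gcomm_a_b]
      ext q <;> simp [single_pair_apply]
    · convert H.mul_mem hf hg using 1
      ext q <;> simp
  have hz (f : IndexTriple n → ZMod 2) : (⟨0, 0, 0, 0, 0, 0, 0, f, 0⟩ : TrialityModel n) ∈ H := by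
    refine Pi.zmod_two_induction (p := fun f => ⟨0, 0, 0, 0, 0, 0, 0, f, 0⟩ ∈ H) H.one_mem
      (fun i => ?_) (fun f g hf hg => ?_) f
    · convert hc (hp (Pi.single ⟨(i.fst, i.snd), i.2.1⟩ 1)) (ha i.trd) using 1
      ext q <;> simp [single_triple_apply]
    · convert H.mul_mem hf hg using 1
      ext q <;> simp
  have ht (f : IndexTriple n → ZMod 2) : (⟨0, 0, 0, 0, 0, 0, 0, 0, f⟩ : TrialityModel n) ∈ H := by
    refine Pi.zmod_two_induction (p := fun f => ⟨0, 0, 0, 0, 0, 0, 0, 0, f⟩ ∈ H) H.one_mem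
      (fun i => ?_) (fun f g hf hg => ?_) f
    · convert hc (hp (Pi.single ⟨(i.fst, i.snd), i.2.1⟩ 1)) (hb i.trd) using 1
      ext q <;> simp [single_triple_apply]
    · convert H.mul_mem hf hg using 1
      ext q <;> simp
  have hα (f : Fin n → ZMod 2) : (⟨f, 0, 0, 0, 0, 0, 0, 0, 0⟩ : TrialityModel n) ∈ H := by
    refine Pi.zmod_two_induction (p := fun f => ⟨f, 0, 0, 0, 0, 0, 0, 0, 0⟩ ∈ H) H.one_mem
      ha (fun f g hf hg => ?_) f
    -- The last two factors cancel the squares and the `u_ij` created by merging two products of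
    -- letters `a`.
    convert H.mul_mem (H.mul_mem (H.mul_mem hf hg) (hs fun i => f i * g i))
      (hu fun q => f q.1.2 * g q.1.1) using 1
    ext q <;> simp [CharTwo.add_self_eq_zero]
  have hβ (f : Fin n → ZMod 2) : (⟨0, f, 0, 0, 0, 0, 0, 0, 0⟩ : TrialityModel n) ∈ H := by
    refine Pi.zmod_two_induction (p := fun f => ⟨0, f, 0, 0, 0, 0, 0, 0, 0⟩ ∈ H) H.one_mem
      hb (fun f g hf hg => ?_) f
    convert H.mul_mem (H.mul_mem (H.mul_mem hf hg) (hr fun i => f i * g i))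
      (hv fun q => f q.1.2 * g q.1.1) using 1
    ext q <;> simp [CharTwo.add_self_eq_zero]
  refine (Subgroup.eq_top_iff' H).mpr fun x => ?_
  convert H.mul_mem (H.mul_mem (H.mul_mem (H.mul_mem (hα x.α) (hβ x.β)) (H.mul_mem (hs x.s)
    (hr x.r))) (H.mul_mem (hu x.u) (hv x.v))) (H.mul_mem (H.mul_mem (hz x.z) (ht x.t))
    (hp x.p)) using 1
  ext q <;> simp

/-! ### Nilpotency of the model -/

open scoped commutatorElement

theorem commutatorElement_eq_gcomm {G : Type*} [Group G] (x y : G) : ⁅x, y⁆ = gcomm x⁻¹ y⁻¹ := by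
  simp [commutatorElement_def, gcomm]

/-- The elements of the model that are congruent to `1` modulo squares and commutators. -/
def frattini (n : ℕ) : Subgroup (TrialityModel n) where
  carrier := {x | (∀ i, x.α i = 0) ∧ ∀ i, x.β i = 0}
  one_mem' := ⟨fun _ => rfl, fun _ => rfl⟩
  mul_mem' := fun {x y} hx hy => ⟨fun i => by simp [hx.1, hy.1], fun i => by simp [hx.2, hy.2]⟩
  inv_mem' := fun hx => hx

/-- The elements of the model all of whose `a`-, `b`- and `p`-coordinates vanish. -/
def centralPart (n : ℕ) : Subgroup (TrialityModel n) where
  carrier := {x | ((∀ i, x.α i = 0) ∧ ∀ i, x.β i = 0) ∧ ∀ q, x.p q = 0}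
  one_mem' := ⟨⟨fun _ => rfl, fun _ => rfl⟩, fun _ => rfl⟩
  mul_mem' := fun {x y} hx hy => ⟨(frattini n).mul_mem hx.1 hy.1, fun q => by
    simp [hx.1.2, hx.2, hy.2]⟩
  inv_mem' := fun {x} hx => ⟨hx.1, fun q => by simp [hx.1.1, hx.2]⟩

/-- `⊤ ≥ frattini n ≥ centralPart n ≥ ⊥` is a central series, as the commutator formulas show. -/
theorem lowerCentralSeries_three : (⊤ : Subgroup (TrialityModel n)).lowerCentralSeries 3 = ⊥ := by
  have h1 : ⁅(⊤ : Subgroup (TrialityModel n)), ⊤⁆ ≤ frattini n := by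
    rw [Subgroup.commutator_le]
    intro x _ y _
    rw [commutatorElement_eq_gcomm]
    exact ⟨gcomm_α _ _, gcomm_β _ _⟩
  have h2 : ⁅frattini n, ⊤⁆ ≤ centralPart n := by
    rw [Subgroup.commutator_le]
    intro x hx y _
    rw [commutatorElement_eq_gcomm]
    refine ⟨⟨gcomm_α _ _, gcomm_β _ _⟩, fun q => ?_⟩
    simp [hx.1, hx.2]
  have h3 : ⁅centralPart n, ⊤⁆ ≤ (⊥ : Subgroup (TrialityModel n)) := by
    rw [Subgroup.commutator_le]
    intro x hx y _
    have hx' := (centralPart n).inv_mem hx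
    rw [commutatorElement_eq_gcomm, gcomm_eq_one_of_central hx'.1.1 hx'.1.2 hx'.2]
    exact Subgroup.mem_bot.mpr rfl
  rw [eq_bot_iff]
  have h4 := (Subgroup.commutator_mono h1 (le_refl (⊤ : Subgroup (TrialityModel n)))).trans h2
  exact (Subgroup.commutator_mono h4 (le_refl (⊤ : Subgroup (TrialityModel n)))).trans h3

/-- Three distinct indices give a nontrivial `z_ijk`; this is where `n ≥ 3` is needed. -/
theorem lowerCentralSeries_two_ne_bot (hn : 3 ≤ n) :
    (⊤ : Subgroup (TrialityModel n)).lowerCentralSeries 2 ≠ ⊥ := by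
  intro h
  let i : Fin n := ⟨0, by omega⟩
  let j : Fin n := ⟨1, by omega⟩
  let k : Fin n := ⟨2, by omega⟩
  have hij : i < j := by simp [i, j]
  have hjk : j < k := by simp [j, k]
  -- The inverses compensate for the convention `⁅x, y⁆ = x y x⁻¹ y⁻¹`. None is needed on `a k`,
  -- since only commuting is tested.
  have h1 : ⁅⁅(a i)⁻¹, (b j)⁻¹⁆, a k⁆ ∈ (⊤ : Subgroup (TrialityModel n)).lowerCentralSeries 2 :=
    Subgroup.commutator_mem_commutator
      (Subgroup.commutator_mem_commutator (Subgroup.mem_top _) (Subgroup.mem_top _))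
      (Subgroup.mem_top _)
  rw [h, Subgroup.mem_bot, commutatorElement_eq_one_iff_commute, commutatorElement_eq_gcomm,
    inv_inv, inv_inv, ← gcomm_eq_one_iff_commute, gcomm_a_b] at h1
  have h2 := congrFun (congrArg TrialityModel.z h1) ⟨(i, j, k), hij, hjk⟩
  simp [IndexTriple.pair12, IndexTriple.pair13, IndexTriple.pair23, Pi.single_apply, hij.ne, hjk.ne,
    hjk.ne', (hij.trans hjk).ne, (hij.trans hjk).ne'] at h2

end TrialityModel

/-! ### Transport of order, class and triality from the model to `G_n`. -/

namespace TrialityGroup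

variable {n : ℕ}

theorem toModel_surjective (n : ℕ) : Function.Surjective (toModel n) := by
  rw [← MonoidHom.range_eq_top]
  exact TrialityModel.eq_top_of_generators_mem (fun i => ⟨a i, toModel_a i⟩)
    (fun i => ⟨b i, toModel_b i⟩)

theorem natCard (n : ℕ) :
    Nat.card (TrialityGroup n) = 2 ^ (4 * n + (3 * n.choose 2 + 2 * n.choose 3)) := by
  obtain ⟨hfin, hle⟩ := finite_and_card_le n
  refine le_antisymm hle ?_
  rw [← TrialityModel.natCard]
  exact Nat.card_le_card_of_surjective _ (toModel_surjective n)

/-- The isomorphism of `G_n` with its model. -/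
noncomputable def equivModel (n : ℕ) : TrialityGroup n ≃* TrialityModel n :=
  MulEquiv.ofBijective (toModel n) (by
    obtain ⟨hfin, hle⟩ := finite_and_card_le n
    refine ((toModel_surjective n).bijective_of_nat_card_le ?_)
    rw [natCard, TrialityModel.natCard])

@[simp] theorem equivModel_a (i : Fin n) : equivModel n (a i) = TrialityModel.a i := toModel_a i
@[simp] theorem equivModel_b (i : Fin n) : equivModel n (b i) = TrialityModel.b i := toModel_b i

@[simp] theorem equivModel_symm_a (i : Fin n) : (equivModel n).symm (TrialityModel.a i) = a i := by
  rw [← equivModel_a, MulEquiv.symm_apply_apply]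
@[simp] theorem equivModel_symm_b (i : Fin n) : (equivModel n).symm (TrialityModel.b i) = b i := by
  rw [← equivModel_b, MulEquiv.symm_apply_apply]

theorem exists_isNilpotent_and_nilpotencyClass_eq (hn : 3 ≤ n) :
    ∃ _ : Group.IsNilpotent (TrialityGroup n), Group.nilpotencyClass (TrialityGroup n) = 3 := by
  have h1 : Group.IsNilpotent (TrialityModel n) :=
    Subgroup.nilpotent_iff_lowerCentralSeries.mpr ⟨3, TrialityModel.lowerCentralSeries_three⟩
  have h2 : Group.IsNilpotent (TrialityGroup n) :=
    Group.nilpotent_of_mulEquiv (equivModel n).symm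
  refine ⟨h2, ?_⟩
  have h3 : Group.nilpotencyClass (TrialityGroup n) = Group.nilpotencyClass (TrialityModel n) :=
    le_antisymm
      (Group.nilpotencyClass_le_of_surjective (equivModel n).symm.toMonoidHom
        (equivModel n).symm.surjective)
      (Group.nilpotencyClass_le_of_surjective (equivModel n).toMonoidHom
        (equivModel n).surjective)
  rw [h3]
  have h4 := Subgroup.lowerCentralSeries_eq_bot_iff_nilpotencyClass_le.mp
    (TrialityModel.lowerCentralSeries_three (n := n))
  have h5 := mt Subgroup.lowerCentralSeries_eq_bot_iff_nilpotencyClass_le.mpr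
    (TrialityModel.lowerCentralSeries_two_ne_bot hn)
  omega

/-- The automorphism of `G_n` corresponding to an automorphism of the model. -/
noncomputable def conjModel (n : ℕ) : MulAut (TrialityModel n) ≃* MulAut (TrialityGroup n) :=
  MulAut.congr (equivModel n).symm

theorem conjModel_apply (f : MulAut (TrialityModel n)) (x : TrialityGroup n) :
    conjModel n f x = (equivModel n).symm (f (equivModel n x)) := rfl

theorem equivModel_conjModel (f : MulAut (TrialityModel n)) (x : TrialityGroup n) :
    equivModel n (conjModel n f x) = f (equivModel n x) := by
  rw [conjModel_apply, MulEquiv.apply_symm_apply]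

theorem isTriality (hn : 0 < n) :
    IsTriality (conjModel n (TrialityModel.sigma n)) (conjModel n (TrialityModel.rho n)) where
  orderOf_sigma := by
    rw [MulEquiv.orderOf_eq, TrialityModel.orderOf_sigma hn]
  orderOf_rho := by
    rw [MulEquiv.orderOf_eq, TrialityModel.orderOf_rho hn]
  sigma_mul_rho_sq := by
    rw [← map_mul, ← map_pow, TrialityModel.sigma_mul_rho_sq, map_one]
  triality x := by
    apply (equivModel n).injective
    simp only [map_mul, map_inv, equivModel_conjModel, map_one]
    have := TrialityModel.triality (equivModel n x)
    simpa only [map_mul, map_inv, TrialityModel.sigma_apply, TrialityModel.rho_apply] using this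

end TrialityGroup

/-! ### Divisions, homomorphisms and terms -/

namespace IsLoop

variable {L : Type u} [MulOneClass L] (h : IsLoop L)
include h

theorem mul_left_cancel {a b c : L} (e : a * b = a * c) : b = c :=
  (h.existsUnique_mul_left a (a * c)).unique e rfl

theorem mul_right_cancel {a b c : L} (e : b * a = c * a) : b = c :=
  (h.existsUnique_mul_right a (c * a)).unique e rfl

theorem leftDiv_eq_iff {a b c : L} : leftDiv a b = c ↔ a * c = b :=
  ⟨fun e => e ▸ h.mul_leftDiv a b, fun e => h.mul_left_cancel ((h.mul_leftDiv a b).trans e.symm)⟩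

theorem rightDiv_eq_iff {a b c : L} : rightDiv b a = c ↔ c * a = b :=
  ⟨fun e => e ▸ h.rightDiv_mul b a, fun e => h.mul_right_cancel ((h.rightDiv_mul b a).trans e.symm)⟩

theorem leftDiv_eq_one_iff {a b : L} : leftDiv a b = 1 ↔ a = b := by
  rw [h.leftDiv_eq_iff, mul_one]

theorem mul_loopCommutator (x y : L) : y * x * loopCommutator x y = x * y := h.mul_leftDiv _ _

theorem mul_loopAssociator (x y z : L) : x * (y * z) * loopAssociator x y z = x * y * z :=
  h.mul_leftDiv _ _

theorem of_mulEquiv {M : Type v} [MulOneClass M] (e : L ≃* M) : IsLoop M where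
  existsUnique_mul_left a b := by
    obtain ⟨x, hx, hu⟩ := h.existsUnique_mul_left (e.symm a) (e.symm b)
    refine ⟨e x, ?_, fun y hy => e.symm_apply_eq.mp (hu (e.symm y) ?_)⟩
    · exact e.symm.injective (by simpa using hx)
    · exact (map_mul e.symm a y).symm.trans (congrArg e.symm hy)
  existsUnique_mul_right a b := by
    obtain ⟨x, hx, hu⟩ := h.existsUnique_mul_right (e.symm a) (e.symm b)
    refine ⟨e x, ?_, fun y hy => e.symm_apply_eq.mp (hu (e.symm y) ?_)⟩
    · exact e.symm.injective (by simpa using hx)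
    · exact (map_mul e.symm y a).symm.trans (congrArg e.symm hy)

theorem map_leftDiv {M : Type v} [MulOneClass M] (hM : IsLoop M) (f : L →* M) (a b : L) :
    f (leftDiv a b) = leftDiv (f a) (f b) := by
  rw [eq_comm, hM.leftDiv_eq_iff, ← map_mul, h.mul_leftDiv]

theorem map_rightDiv {M : Type v} [MulOneClass M] (hM : IsLoop M) (f : L →* M) (a b : L) :
    f (rightDiv b a) = rightDiv (f b) (f a) := by
  rw [eq_comm, hM.rightDiv_eq_iff, ← map_mul, h.rightDiv_mul]

theorem map_eval {M : Type v} [MulOneClass M] (hM : IsLoop M) (f : L →* M) (w : ℕ → L)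
    (t : LoopTerm) : f (t.eval w) = t.eval (fun i => f (w i)) := by
  induction t with
  | var i => rfl
  | one => exact map_one f
  | mul s t hs ht => rw [LoopTerm.eval, LoopTerm.eval, map_mul, hs, ht]
  | leftDiv s t hs ht => rw [LoopTerm.eval, LoopTerm.eval, h.map_leftDiv hM, hs, ht]
  | rightDiv s t hs ht => rw [LoopTerm.eval, LoopTerm.eval, h.map_rightDiv hM, hs, ht]

/-- A subdirect product inherits the common identities of its factors. Multiplicative maps suffice,
because divisions in a loop are determined by the product. -/
theorem satisfiesIdentity_of_jointly_injective {ι : Sort*} {M : ι → Type v}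
    [∀ i, MulOneClass (M i)] (hM : ∀ i, IsLoop (M i)) (f : ∀ i, L →* M i)
    (hf : ∀ a b : L, (∀ i, f i a = f i b) → a = b) {s t : LoopTerm}
    (hst : ∀ i, SatisfiesIdentity (M i) s t) : SatisfiesIdentity L s t := fun w =>
  hf _ _ fun i => by rw [h.map_eval (hM i), h.map_eval (hM i), hst i]

end IsLoop

namespace LoopTerm

/-- A bound for the indices of the variables of a term. -/
def bound : LoopTerm → ℕ
  | .var i => i + 1
  | .one => 0
  | .mul s t => max s.bound t.bound
  | .leftDiv s t => max s.bound t.bound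
  | .rightDiv s t => max s.bound t.bound

theorem eval_congr {L : Type u} [MulOneClass L] {v w : ℕ → L} :
    ∀ {t : LoopTerm}, (∀ i < t.bound, v i = w i) → t.eval v = t.eval w
  | .var i, h => h i (Nat.lt_succ_self i)
  | .one, _ => rfl
  | .mul s t, h => by
    rw [eval, eval, eval_congr (t := s) fun i hi => h i (lt_max_of_lt_left hi),
      eval_congr (t := t) fun i hi => h i (lt_max_of_lt_right hi)]
  | .leftDiv s t, h => by
    rw [eval, eval, eval_congr (t := s) fun i hi => h i (lt_max_of_lt_left hi),
      eval_congr (t := t) fun i hi => h i (lt_max_of_lt_right hi)]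
  | .rightDiv s t, h => by
    rw [eval, eval, eval_congr (t := s) fun i hi => h i (lt_max_of_lt_left hi),
      eval_congr (t := t) fun i hi => h i (lt_max_of_lt_right hi)]

/-- The commutator of two terms. -/
def comm (s t : LoopTerm) : LoopTerm := .leftDiv (.mul t s) (.mul s t)

/-- The associator of three terms. -/
def assoc (s t r : LoopTerm) : LoopTerm := .leftDiv (.mul s (.mul t r)) (.mul (.mul s t) r)

end LoopTerm

/-! ### Code loops belong to `𝓔` -/

/-- Modulo `A` the loop is an elementary abelian 2-group, so squares, commutators and associators
lie in `A`, whose elements are central with square 1. -/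
theorem IsCodeLoop.inVarietyE {L : Type u} [MulOneClass L] (h : IsCodeLoop L) : InVarietyE L := by
  obtain ⟨A, hA, hcard, V, _, π, -, hV, hker⟩ := h.exists_central
  have hL : IsLoop L := h.toIsLoop
  have hmem {x : L} (hx : π x = 1) : x ∈ A := (hker x).mp hx
  have hcentral {c : L} (hc : c ∈ A) : IsMulCentral c := hA hc
  -- `A` is given only as a submonoid with two elements; if `c * c ≠ 1`, then `1`, `c`, `c * c`
  -- would be three distinct elements of it.
  have hsq : ∀ c ∈ A, c * c = 1 := by
    intro c hc
    by_contra hne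
    have hc1 : c ≠ 1 := by rintro rfl; exact hne (mul_one 1)
    have hcc : c * c ≠ c := fun e => hc1 (hL.mul_left_cancel (e.trans (mul_one c).symm))
    have : Finite A := Nat.finite_of_card_ne_zero (by rw [hcard]; decide)
    have := Fintype.ofFinite A
    rw [Nat.card_eq_fintype_card] at hcard
    have h3 : 2 < Fintype.card A := Fintype.two_lt_card_iff.mpr
      ⟨1, ⟨c, hc⟩, ⟨c * c, A.mul_mem hc hc⟩, fun e => hc1 (congrArg Subtype.val e).symm,
        fun e => hne (congrArg Subtype.val e).symm, fun e => hcc (congrArg Subtype.val e).symm⟩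
    omega
  have hS (x : L) : x * x ∈ A := hmem (by rw [map_mul, hV])
  have hC (x y : L) : loopCommutator x y ∈ A := by
    refine hmem ?_
    have e := congrArg π (hL.mul_loopCommutator x y)
    rwa [map_mul, map_mul, map_mul, mul_comm (π y), mul_eq_left] at e
  have hAs (x y z : L) : loopAssociator x y z ∈ A := by
    refine hmem ?_
    have e := congrArg π (hL.mul_loopAssociator x y z)
    rwa [map_mul, map_mul, map_mul, map_mul, map_mul, ← mul_assoc (π x) (π y) (π z), mul_eq_left] at e
  have hcomm {c : L} (hc : c ∈ A) (y : L) : loopCommutator c y = 1 :=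
    hL.leftDiv_eq_one_iff.mpr ((hcentral hc).comm y).symm
  have hassoc {c : L} (hc : c ∈ A) (y z : L) : loopAssociator c y z = 1 :=
    hL.leftDiv_eq_one_iff.mpr ((hcentral hc).left_assoc y z)
  exact
    { toIsMoufangLoop := h.toIsMoufangLoop
      pow_four := fun x => hsq _ (hS x)
      commutator_sq := fun x y => hsq _ (hC x y)
      associator_sq := fun x y z => hsq _ (hAs x y z)
      commutator_of_sq := fun x => hcomm (hS x)
      commutator_of_commutator := fun x y => hcomm (hC x y)
      commutator_of_associator := fun x y z => hcomm (hAs x y z)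
      associator_of_sq := fun x => hassoc (hS x)
      associator_of_commutator := fun x y => hassoc (hC x y)
      associator_of_associator := fun x y z => hassoc (hAs x y z) }

theorem InVarietyGeneratedByCodeLoops.inVarietyE {L : Type u} [MulOneClass L]
    (h : InVarietyGeneratedByCodeLoops L) : InVarietyE L := by
  obtain ⟨hL, hid⟩ := h
  -- All defining conditions are identities in at most five variables; each is applied with the
  -- unused slots filled by 1.
  have key (s t : LoopTerm)
      (hst : ∀ (C : Type) [MulOneClass C], InVarietyE C → SatisfiesIdentity C s t)
      (x y z t' s' : L) :
      s.eval (fun i => [x, y, z, t', s'].getD i 1) = t.eval (fun i => [x, y, z, t', s'].getD i 1) :=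
    hid s t (fun C _ hC => hst C hC.inVarietyE) _
  let X : LoopTerm := .var 0
  let Y : LoopTerm := .var 1
  let Z : LoopTerm := .var 2
  let T : LoopTerm := .var 3
  let S : LoopTerm := .var 4
  exact
    { toIsLoop := hL
      moufang_left := fun x y z => key (.mul (.mul (.mul X Y) X) Z) (.mul X (.mul Y (.mul X Z)))
        (fun C _ hC v => hC.moufang_left _ _ _) x y z 1 1
      moufang_right := fun x y z => key (.mul (.mul (.mul X Y) Z) Y) (.mul X (.mul Y (.mul Z Y)))
        (fun C _ hC v => hC.moufang_right _ _ _) x y z 1 1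
      moufang_middle := fun x y z => key (.mul (.mul X Y) (.mul Z X)) (.mul (.mul X (.mul Y Z)) X)
        (fun C _ hC v => hC.moufang_middle _ _ _) x y z 1 1
      pow_four := fun x => key (.mul (.mul X X) (.mul X X)) .one
        (fun C _ hC v => hC.pow_four _) x 1 1 1 1
      commutator_sq := fun x y => key (.mul (.comm X Y) (.comm X Y)) .one
        (fun C _ hC v => hC.commutator_sq _ _) x y 1 1 1
      associator_sq := fun x y z => key (.mul (.assoc X Y Z) (.assoc X Y Z)) .one
        (fun C _ hC v => hC.associator_sq _ _ _) x y z 1 1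
      commutator_of_sq := fun x y => key (.comm (.mul X X) Y) .one
        (fun C _ hC v => hC.commutator_of_sq _ _) x y 1 1 1
      commutator_of_commutator := fun x y t => key (.comm (.comm X Y) T) .one
        (fun C _ hC v => hC.commutator_of_commutator _ _ _) x y 1 t 1
      commutator_of_associator := fun x y z t => key (.comm (.assoc X Y Z) T) .one
        (fun C _ hC v => hC.commutator_of_associator _ _ _ _) x y z t 1
      associator_of_sq := fun x y z => key (.assoc (.mul X X) Y Z) .one
        (fun C _ hC v => hC.associator_of_sq _ _ _) x y z 1 1
      associator_of_commutator := fun x y z t => key (.assoc (.comm X Y) Z T) .one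
        (fun C _ hC v => hC.associator_of_commutator _ _ _ _) x y z t 1
      associator_of_associator := fun x y z t s => key (.assoc (.assoc X Y Z) T S) .one
        (fun C _ hC v => hC.associator_of_associator _ _ _ _ _) x y z t s }

/-! ### The involutive centre of a loop -/

/-- The central elements of order at most `2`, written additively. -/
def InvolutiveCenter (L : Type u) [MulOneClass L] : Type u :=
  {c : L // IsMulCentral c ∧ c * c = 1}

namespace InvolutiveCenter

variable {L : Type u} [MulOneClass L]

theorem isMulCentral_mul {c d : L} (hc : IsMulCentral c) (hd : IsMulCentral d) :
    IsMulCentral (c * d) := Set.mul_mem_center (M := L) hc hd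

instance : Zero (InvolutiveCenter L) := ⟨⟨1, Set.one_mem_center, mul_one 1⟩⟩

instance : Add (InvolutiveCenter L) where
  add c d := ⟨c.1 * d.1, isMulCentral_mul c.2.1 d.2.1, by
    rw [← c.2.1.left_assoc, ← c.2.1.left_comm, d.2.2, mul_one, c.2.2]⟩

instance : Neg (InvolutiveCenter L) := ⟨fun c => c⟩

instance : AddCommGroup (InvolutiveCenter L) where
  add_assoc c d e := Subtype.ext (c.2.1.left_assoc d.1 e.1).symm
  zero_add c := Subtype.ext (one_mul c.1)
  add_zero c := Subtype.ext (mul_one c.1)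
  neg_add_cancel c := Subtype.ext c.2.2
  add_comm c d := Subtype.ext (c.2.1.comm d.1)
  nsmul := nsmulRec
  zsmul := zsmulRec

theorem add_self (c : InvolutiveCenter L) : c + c = 0 := Subtype.ext c.2.2

noncomputable instance : Module (ZMod 2) (InvolutiveCenter L) :=
  AddCommGroup.zmodModule fun c => by rw [two_nsmul, add_self]

/-- Central corrections become an additive action that can be pulled out of any bracketing, so
identities between loop words reduce to sums in a Z/2-module. -/
instance : AddAction (InvolutiveCenter L) L where
  vadd c x := c.1 * x
  zero_vadd x := one_mul x
  add_vadd c d x := (c.2.1.left_assoc d.1 x).symm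

variable (c d : InvolutiveCenter L) (x y : L)

theorem vadd_mul : (c +ᵥ x) * y = c +ᵥ x * y := (c.2.1.left_assoc x y).symm

theorem mul_vadd : x * (c +ᵥ y) = c +ᵥ x * y := (c.2.1.left_comm x y).symm

theorem vadd_vadd_self : c +ᵥ (c +ᵥ x) = x := by
  rw [vadd_vadd, add_self, zero_vadd]

theorem eq_vadd_iff {c : InvolutiveCenter L} {x y : L} : x = c +ᵥ y ↔ c +ᵥ x = y :=
  ⟨fun e => by rw [e, vadd_vadd_self], fun e => by rw [← e, vadd_vadd_self]⟩

end InvolutiveCenter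

theorem IsLoop.vadd_right_cancel {L : Type u} [MulOneClass L] (h : IsLoop L)
    {c d : InvolutiveCenter L} {x : L} (e : c +ᵥ x = d +ᵥ x) : c = d :=
  Subtype.ext (h.mul_right_cancel e)

namespace InVarietyE

variable {L : Type u} [MulOneClass L] (h : InVarietyE L)

section
include h

/-- The hypotheses give `w t = t w` and `w (s t) = (w s) t`. The remaining law `(a b) w = a (b w)`
comes from the middle Moufang identity `(w a)(b w) = (w (a b)) w` by cancelling `w` on the left. -/
theorem isMulCentral_of {w : L} (h1 : ∀ t, loopCommutator w t = 1)
    (h2 : ∀ s t, loopAssociator w s t = 1) : IsMulCentral w := by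
  have hL := h.toIsLoop
  have hc (t : L) : w * t = t * w := (hL.leftDiv_eq_one_iff.mp (h1 t)).symm
  have ha (s t : L) : w * (s * t) = w * s * t := hL.leftDiv_eq_one_iff.mp (h2 s t)
  refine ⟨hc, ha, fun a b => ?_⟩
  have e := h.moufang_middle w a b
  rw [← ha, ← ha] at e
  exact (hL.mul_left_cancel e).symm

end

/-! ### The calculus of associators and commutators in `𝓔`. -/

/-- The square of an element, as a central involution. -/
def sq (x : L) : InvolutiveCenter L :=
  ⟨x * x, h.isMulCentral_of (h.commutator_of_sq x) (h.associator_of_sq x), h.pow_four x⟩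

/-- The commutator of two elements, as a central involution. -/
noncomputable def comm (x y : L) : InvolutiveCenter L :=
  ⟨loopCommutator x y, h.isMulCentral_of (h.commutator_of_commutator x y)
    (h.associator_of_commutator x y), h.commutator_sq x y⟩

/-- The associator of three elements, as a central involution. -/
noncomputable def assoc (x y z : L) : InvolutiveCenter L :=
  ⟨loopAssociator x y z, h.isMulCentral_of (h.commutator_of_associator x y z)
    (h.associator_of_associator x y z), h.associator_sq x y z⟩

theorem mul_self (x : L) : x * x = h.sq x +ᵥ (1 : L) := (mul_one _).symm

theorem mul_comm' (x y : L) : x * y = h.comm x y +ᵥ y * x :=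
  (h.mul_loopCommutator x y).symm.trans ((h.comm x y).2.1.comm (y * x)).symm

theorem mul_assoc' (x y z : L) : x * y * z = h.assoc x y z +ᵥ x * (y * z) :=
  (h.mul_loopAssociator x y z).symm.trans ((h.assoc x y z).2.1.comm _).symm

theorem mul_assoc_symm (x y z : L) : x * (y * z) = h.assoc x y z +ᵥ x * y * z :=
  (InvolutiveCenter.eq_vadd_iff.mp (h.mul_assoc' x y z)).symm

theorem comm_eq_of {x y : L} {c : InvolutiveCenter L} (e : x * y = c +ᵥ y * x) : h.comm x y = c :=
  h.vadd_right_cancel ((h.mul_comm' x y).symm.trans e)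

theorem assoc_eq_of {x y z : L} {c : InvolutiveCenter L} (e : x * y * z = c +ᵥ x * (y * z)) :
    h.assoc x y z = c :=
  h.vadd_right_cancel ((h.mul_assoc' x y z).symm.trans e)

open InvolutiveCenter

@[simp] theorem assoc_vadd_left (c : InvolutiveCenter L) (x y z : L) :
    h.assoc (c +ᵥ x) y z = h.assoc x y z :=
  h.assoc_eq_of (by simp only [vadd_mul]; rw [h.mul_assoc', vadd_comm])

@[simp] theorem assoc_vadd_mid (c : InvolutiveCenter L) (x y z : L) :
    h.assoc x (c +ᵥ y) z = h.assoc x y z :=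
  h.assoc_eq_of (by simp only [vadd_mul, mul_vadd]; rw [h.mul_assoc', vadd_comm])

@[simp] theorem assoc_vadd_right (c : InvolutiveCenter L) (x y z : L) :
    h.assoc x y (c +ᵥ z) = h.assoc x y z :=
  h.assoc_eq_of (by simp only [mul_vadd]; rw [h.mul_assoc', vadd_comm])

theorem comm_symm (x y : L) : h.comm x y = h.comm y x :=
  h.comm_eq_of (eq_vadd_iff.mpr (h.mul_comm' y x).symm)

@[simp] theorem comm_one_left (x : L) : h.comm 1 x = 0 := h.comm_eq_of (by simp)
@[simp] theorem assoc_one_left (x y : L) : h.assoc 1 x y = 0 := h.assoc_eq_of (by simp)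
@[simp] theorem assoc_one_mid (x y : L) : h.assoc x 1 y = 0 := h.assoc_eq_of (by simp)
@[simp] theorem assoc_one_right (x y : L) : h.assoc x y 1 = 0 := h.assoc_eq_of (by simp)

theorem assoc_self_left (x z : L) : h.assoc x x z = 0 :=
  h.assoc_eq_of (by simpa using h.moufang_left x 1 z)

theorem assoc_flexible (x y : L) : h.assoc x y x = 0 :=
  h.assoc_eq_of (by simpa using (h.moufang_middle x 1 y).symm)

/-- Both sides of the left Moufang identity are central corrections of `(x y)(x z)`, and these must
agree. The right and middle identities are translated in the same spirit. -/
theorem assoc_moufang_left (x y z : L) : h.assoc (x * y) x z = h.assoc x y (x * z) := by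
  have e := h.moufang_left x y z
  rw [h.mul_assoc', h.mul_assoc_symm x y] at e
  exact h.vadd_right_cancel e

theorem assoc_moufang_right (x y z : L) : h.assoc (x * y) z y = h.assoc x y (z * y) := by
  have e := h.moufang_right x y z
  rw [h.mul_assoc', h.mul_assoc_symm x y] at e
  exact h.vadd_right_cancel e

theorem assoc_moufang_middle (x y z : L) : h.assoc y z x = h.assoc x y (z * x) := by
  have e := h.moufang_middle x y z
  rw [h.mul_assoc' x y (z * x), h.mul_assoc' x (y * z) x, h.assoc_flexible, zero_vadd,
    h.mul_assoc' y z x, mul_vadd] at e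
  exact (h.vadd_right_cancel e).symm

theorem assoc_symm_mul_left (x y z w : L) : h.assoc (x * y) z w = h.assoc (y * x) z w := by
  rw [h.mul_comm' x y, assoc_vadd_left]

theorem assoc_symm_mul_mid (x y z w : L) : h.assoc x (y * z) w = h.assoc x (z * y) w := by
  rw [h.mul_comm' y z, assoc_vadd_mid]

theorem assoc_symm_mul_right (x y z w : L) : h.assoc x y (z * w) = h.assoc x y (w * z) := by
  rw [h.mul_comm' z w, assoc_vadd_right]

theorem mul_mul_self (x y : L) : x * (x * y) = h.sq x +ᵥ y := by
  rw [h.mul_assoc_symm, h.assoc_self_left, zero_vadd, h.mul_self, vadd_mul, one_mul]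

/-- A step towards symmetry of the associator. The method, here and in `assoc_reverse`, is to
multiply an argument by a suitable factor, apply the Moufang relations, and absorb the doubled
factor by `x (x y) = x² y`, since associators ignore central factors. -/
theorem assoc_mul_right_of_mid (x y z : L) : h.assoc x y (y * z) = h.assoc x y z := by
  have e1 (x y z : L) : h.assoc (x * y) x z = h.assoc y z x := by
    rw [h.assoc_moufang_left, h.assoc_symm_mul_right, ← h.assoc_moufang_middle]
  have e2 : h.assoc x y z = h.assoc (y * x) z y := by
    rw [← e1 y (y * x) z, h.mul_mul_self, assoc_vadd_left]
  rw [e2, h.assoc_symm_mul_left, h.assoc_moufang_right, h.assoc_symm_mul_right]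

theorem assoc_reverse (x y z : L) : h.assoc x y z = h.assoc z y x := by
  have e1 (x y z : L) : h.assoc y (x * z) x = h.assoc x y z := by
    rw [h.assoc_moufang_middle, h.assoc_symm_mul_right x y (x * z) x, h.mul_mul_self,
      assoc_vadd_right]
  rw [← e1 x y z, ← h.assoc_mul_right_of_mid y (x * z) x, h.assoc_symm_mul_mid,
    h.assoc_symm_mul_right, h.assoc_symm_mul_mid, h.mul_mul_self, assoc_vadd_right]
  rw [h.assoc_symm_mul_mid, e1 z y x]

theorem assoc_swap_right (x y z : L) : h.assoc x y z = h.assoc x z y := by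
  have e1 : h.assoc (x * y) y z = h.assoc x y z := by
    rw [h.assoc_reverse, h.assoc_symm_mul_right, h.assoc_mul_right_of_mid, h.assoc_reverse]
  rw [← e1, h.assoc_symm_mul_left, h.assoc_moufang_left, h.assoc_symm_mul_right,
    ← h.assoc_moufang_middle]

theorem assoc_swap_left (x y z : L) : h.assoc x y z = h.assoc y x z := by
  rw [h.assoc_reverse, h.assoc_swap_right, h.assoc_reverse]

/-- The two ways of rebracketing `((x y) z) w` as `x (y (z w))` cost the same. -/
theorem assoc_pentagon (x y z w : L) :
    h.assoc x y z + h.assoc x (y * z) w + h.assoc y z w =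
      h.assoc (x * y) z w + h.assoc x y (z * w) := by
  refine h.vadd_right_cancel (x := x * (y * (z * w))) ?_
  calc _ = x * y * z * w := by
        rw [h.mul_assoc' x y z, vadd_mul, h.mul_assoc' x (y * z) w, h.mul_assoc' y z w, mul_vadd,
          vadd_vadd, vadd_vadd]
    _ = _ := by rw [h.mul_assoc' (x * y) z w, h.mul_assoc' x y (z * w), vadd_vadd]

/-- Let `D` be the defect of additivity. It is symmetric in its first two and in its last two
arguments. The pentagon becomes `D y z x w + D z w x y = D x y z w` (`hc`), and comparing it with
its version for `x`, `y` exchanged gives `hs`. All three terms are then equal, so `D + D = D` and `D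
= 0`. -/
theorem assoc_mul_left (x y z w : L) :
    h.assoc (x * y) z w = h.assoc x z w + h.assoc y z w := by
  let D (x y z w : L) := h.assoc (x * y) z w + h.assoc x z w + h.assoc y z w
  have hl (x y z w : L) : D x y z w = D y x z w := by
    simp only [D]
    rw [h.assoc_symm_mul_left]
    abel
  have hr (x y z w : L) : D x y z w = D x y w z := by
    simp only [D]
    rw [h.assoc_swap_right _ z w, h.assoc_swap_right x z w, h.assoc_swap_right y z w]
  have hc (x y z w : L) : D y z x w + D z w x y = D x y z w := by
    have e := h.assoc_pentagon x y z w
    rw [h.assoc_swap_left x (y * z) w, h.assoc_swap_right x y (z * w),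
      h.assoc_swap_left x (z * w) y] at e
    simp only [D]
    rw [h.assoc_swap_left z x w, h.assoc_swap_left z x y, h.assoc_swap_right x z y,
      h.assoc_swap_left w x y, h.assoc_swap_right x w y, h.assoc_swap_left y x w]
    linear_combination (norm := abel) e + add_self (h.assoc x y w) +
      add_self (h.assoc (z * w) x y) - add_self (h.assoc y z w)
  have hs (x y z w : L) : D y z x w = D x z y w := by
    have e1 := hc x y z w
    have e2 := hc y x z w
    rw [hl y x, hr z w y x, ← e1] at e2
    exact (add_right_cancel e2).symm
  have h1 : D y z x w = D x y z w := by rw [hs, hl, hs, hl]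
  have h2 : D z w x y = D x y z w := by rw [hs, hl, hr, hs, hl, hr]
  have h3 := hc x y z w
  rw [h1, h2, add_self] at h3
  exact eq_neg_of_add_eq_zero_left ((add_assoc _ _ _).symm.trans h3.symm)

theorem assoc_mul_mid (x y z w : L) :
    h.assoc x (y * z) w = h.assoc x y w + h.assoc x z w := by
  rw [h.assoc_swap_left, h.assoc_mul_left, h.assoc_swap_left y, h.assoc_swap_left z]

theorem assoc_mul_right (x y z w : L) :
    h.assoc x y (z * w) = h.assoc x y z + h.assoc x y w := by
  rw [h.assoc_swap_right, h.assoc_mul_mid, h.assoc_swap_right x z, h.assoc_swap_right x w]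

/-- Moving `z` through `x y` costs two commutators and three associators. By symmetry the
associators are equal, so one of them remains. -/
theorem comm_mul_left (x y z : L) :
    h.comm (x * y) z = h.comm x z + h.comm y z + h.assoc x y z := by
  refine h.comm_eq_of ?_
  rw [h.mul_assoc' x y z, h.mul_comm' y z, mul_vadd, h.mul_assoc_symm x z y, h.mul_comm' x z,
    vadd_mul, h.mul_assoc' z x y]
  simp only [vadd_vadd]
  congr 1
  rw [h.assoc_swap_right x z y, h.assoc_swap_left z x y, h.assoc_swap_right x z y]
  linear_combination (norm := abel) add_self (h.assoc x y z)

end InVarietyE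

/-! ### Normal products in a loop of `𝓔` -/

/-- The power `g ^ e` with an exponent `e` modulo `2`. -/
def bitPow {L : Type u} [MulOneClass L] (g : L) (e : ZMod 2) : L := if e = 0 then 1 else g

/-- The left-normed product `y_0 ^ x_0 * y_1 ^ x_1 * ⋯ * y_(k-1) ^ x_(k-1)`. -/
def normalProd {L : Type u} [MulOneClass L] (y : ℕ → L) (x : ℕ → ZMod 2) : ℕ → L
  | 0 => 1
  | k + 1 => normalProd y x k * bitPow (y k) (x k)

theorem ZMod.two_cases (e : ZMod 2) : e = 0 ∨ e = 1 := by revert e; decide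

section

variable {L : Type u} [MulOneClass L]

@[simp] theorem bitPow_zero (g : L) : bitPow g 0 = 1 := if_pos rfl
@[simp] theorem bitPow_one (g : L) : bitPow g 1 = g := if_neg one_ne_zero

@[simp] theorem normalProd_zero (y : ℕ → L) (k : ℕ) : normalProd y (fun _ => 0) k = 1 := by
  induction k with
  | zero => rfl
  | succ k ih => rw [normalProd, ih, bitPow_zero, mul_one]

theorem normalProd_single (y : ℕ → L) (i k : ℕ) :
    normalProd y (fun j => if j = i then 1 else 0) k = if i < k then y i else 1 := by
  induction k with
  | zero => rfl
  | succ k ih =>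
    rw [normalProd, ih]
    rcases lt_trichotomy i k with h | rfl | h
    · simp [h, h.ne', Nat.lt_succ_of_lt h]
    · simp
    · simp [h.ne, show ¬ i < k by omega, show ¬ i < k + 1 by omega]

end

namespace InVarietyE

open InvolutiveCenter

variable {L : Type u} [MulOneClass L] (h : InVarietyE L)

theorem bitPow_mul_bitPow (g : L) (e e' : ZMod 2) :
    bitPow g e * bitPow g e' = ((e * e') • h.sq g) +ᵥ bitPow g (e + e') := by
  rcases ZMod.two_cases e with rfl | rfl <;> rcases ZMod.two_cases e' with rfl | rfl
  · simp
  · simp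
  · simp
  · simp [h.mul_self, CharTwo.add_self_eq_zero]

theorem assoc_bitPow (u w g : L) (e : ZMod 2) : h.assoc u w (bitPow g e) = e • h.assoc u w g := by
  rcases ZMod.two_cases e with rfl | rfl <;> simp

theorem assoc_bitPow_mid (u w g : L) (e : ZMod 2) :
    h.assoc u (bitPow g e) w = e • h.assoc u g w := by
  rcases ZMod.two_cases e with rfl | rfl <;> simp

theorem assoc_bitPow_left (u w g : L) (e : ZMod 2) :
    h.assoc (bitPow g e) u w = e • h.assoc g u w := by
  rcases ZMod.two_cases e with rfl | rfl <;> simp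

theorem comm_bitPow (g u : L) (e : ZMod 2) : h.comm (bitPow g e) u = e • h.comm g u := by
  rcases ZMod.two_cases e with rfl | rfl <;> simp

theorem assoc_bitPow_bitPow_right (u g : L) (e e' : ZMod 2) :
    h.assoc u (bitPow g e) (bitPow g e') = 0 := by
  rw [assoc_bitPow, assoc_swap_right, assoc_bitPow, assoc_reverse, assoc_self_left, smul_zero,
    smul_zero]

theorem assoc_bitPow_bitPow_left (u g : L) (e e' : ZMod 2) :
    h.assoc (bitPow g e) (bitPow g e') u = 0 := by
  rw [assoc_reverse, assoc_bitPow_bitPow_right]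

open Finset

variable (y : ℕ → L)

theorem assoc_normalProd_left (x : ℕ → ZMod 2) (u w : L) (k : ℕ) :
    h.assoc (normalProd y x k) u w = ∑ i ∈ range k, x i • h.assoc (y i) u w := by
  induction k with
  | zero => simp [normalProd]
  | succ k ih => rw [normalProd, h.assoc_mul_left, ih, assoc_bitPow_left, sum_range_succ]

theorem assoc_normalProd_mid (x : ℕ → ZMod 2) (u w : L) (k : ℕ) :
    h.assoc u (normalProd y x k) w = ∑ i ∈ range k, x i • h.assoc u (y i) w := by
  rw [h.assoc_swap_left, assoc_normalProd_left]
  exact sum_congr rfl fun i _ => by rw [h.assoc_swap_left]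

theorem assoc_normalProd_normalProd (x x' : ℕ → ZMod 2) (u : L) (k : ℕ) :
    h.assoc (normalProd y x k) (normalProd y x' k) u =
      ∑ j ∈ range k, ∑ i ∈ range j, (x i * x' j + x j * x' i) • h.assoc (y i) (y j) u := by
  induction k with
  | zero => simp [normalProd]
  | succ k ih =>
    rw [sum_range_succ, ← ih, normalProd, normalProd, h.assoc_mul_left, h.assoc_mul_mid,
      h.assoc_mul_mid, assoc_bitPow_bitPow_left, add_zero, add_assoc]
    congr 1
    rw [assoc_bitPow_mid, assoc_bitPow_left, assoc_normalProd_left, assoc_normalProd_mid,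
      smul_sum, smul_sum, ← sum_add_distrib]
    refine sum_congr rfl fun i _ => ?_
    rw [h.assoc_swap_left (y k), smul_smul, smul_smul, ← add_smul, mul_comm (x' k)]

theorem comm_normalProd (x : ℕ → ZMod 2) (u : L) (k : ℕ) :
    h.comm (normalProd y x k) u = ∑ i ∈ range k, x i • h.comm (y i) u +
      ∑ j ∈ range k, ∑ i ∈ range j, (x i * x j) • h.assoc (y i) (y j) u := by
  induction k with
  | zero => simp [normalProd]
  | succ k ih =>
    rw [sum_range_succ, sum_range_succ, normalProd, h.comm_mul_left, ih, comm_bitPow,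
      assoc_bitPow_mid, assoc_normalProd_left, smul_sum]
    have e : ∑ i ∈ range k, (x i * x k) • h.assoc (y i) (y k) u =
        ∑ i ∈ range k, x k • x i • h.assoc (y i) (y k) u :=
      sum_congr rfl fun i _ => by rw [smul_smul, mul_comm]
    rw [e]
    abel

/-- The cocycle of normal products. -/
noncomputable def normalCocycle (x x' : ℕ → ZMod 2) (k : ℕ) : InvolutiveCenter L :=
  ∑ l ∈ range k, ((x l * x' l) • h.sq (y l) +
    (∑ i ∈ range l, (x l * x' i) • h.comm (y i) (y l) +
    ∑ j ∈ range l, ∑ i ∈ range j,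
      (x i * x' j * x' l + x j * x' i * x' l + x l * x' i * x' j) • h.assoc (y i) (y j) (y l)))

/-- Induction on the number of factors: `(S g^e)(S' g^e')` is rebracketed to `(S S') g^(e+e')`. The
costs are associators of `S`, `S'`, `g`, the square of `g`, and the commutator of `g^e` with `S'`.
-/
theorem normalProd_mul_normalProd (x x' : ℕ → ZMod 2) (k : ℕ) :
    normalProd y x k * normalProd y x' k =
      h.normalCocycle y x x' k +ᵥ normalProd y (fun i => x i + x' i) k := by
  induction k with
  | zero => simp [normalProd, normalCocycle]
  | succ k ih =>
    set S := normalProd y x k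
    set S' := normalProd y x' k
    have e : S * bitPow (y k) (x k) * (S' * bitPow (y k) (x' k)) =
        (x k • h.assoc S S' (y k) + x k • h.comm (y k) S' + (x k * x' k) • h.sq (y k) +
          (x k + x' k) • h.assoc S S' (y k)) +ᵥ
          (S * S') * bitPow (y k) (x k + x' k) := by
      rw [h.mul_assoc' S, h.mul_assoc_symm (bitPow _ _) S', h.mul_comm' _ S', vadd_mul,
        h.mul_assoc' S', h.bitPow_mul_bitPow]
      simp only [mul_vadd, vadd_vadd]
      rw [h.mul_assoc_symm S S', vadd_vadd, h.assoc_mul_right,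
        h.assoc_bitPow_bitPow_right, h.assoc_bitPow_bitPow_right,
        h.assoc_swap_left (bitPow _ _) S', h.assoc_bitPow_bitPow_right, h.comm_bitPow,
        h.assoc_bitPow, h.assoc_swap_right S, h.assoc_bitPow]
      congr 1
      abel
    rw [normalProd, normalProd, e, ih, vadd_mul, vadd_vadd, normalProd]
    congr 1
    rw [normalCocycle, normalCocycle, sum_range_succ, add_comm]
    congr 1
    -- The first two monomials expand the associator of `S`, `S'`, `y k`; the third is the quadratic
    -- part of the commutator of `S'` with `y k`.
    have e3 : ∑ j ∈ range k, ∑ i ∈ range j,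
        (x i * x' j * x' k + x j * x' i * x' k + x k * x' i * x' j) • h.assoc (y i) (y j) (y k) =
        x' k • h.assoc S S' (y k) + x k • ∑ j ∈ range k, ∑ i ∈ range j,
          (x' i * x' j) • h.assoc (y i) (y j) (y k) := by
      rw [assoc_normalProd_normalProd]
      simp only [smul_sum, ← sum_add_distrib, smul_smul, ← add_smul]
      refine sum_congr rfl fun j _ => sum_congr rfl fun i _ => ?_
      congr 1
      ring
    have e2 : ∑ i ∈ range k, (x k * x' i) • h.comm (y i) (y k) =
        x k • ∑ i ∈ range k, x' i • h.comm (y i) (y k) := by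
      simp only [smul_sum, smul_smul]
    rw [e2, e3, h.comm_symm, h.comm_normalProd, smul_add, add_smul]
    -- The associator of `S`, `S'`, `y k` occurs with coefficient `x k + (x k + x' k)`, which leaves
    -- `x' k`.
    linear_combination (norm := abel) add_self (x k • h.assoc S S' (y k))

end InVarietyE

/-! ### Central extensions by Moufang cocycles -/

/-- A normalized cocycle whose central extension is a Moufang loop. -/
structure MoufangCocycle (V Z : Type*) [AddCommGroup V] [AddCommGroup Z] where
  toFun : V → V → Z
  zero_left : ∀ x, toFun 0 x = 0
  zero_right : ∀ x, toFun x 0 = 0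
  left : ∀ x y z, toFun x y + toFun (x + y) x + toFun (x + y + x) z =
    toFun x z + toFun y (x + z) + toFun x (y + (x + z))
  right : ∀ x y z, toFun x y + toFun (x + y) z + toFun (x + y + z) y =
    toFun z y + toFun y (z + y) + toFun x (y + (z + y))
  middle : ∀ x y z, toFun x y + toFun z x + toFun (x + y) (z + x) =
    toFun y z + toFun x (y + z) + toFun (x + (y + z)) x

namespace MoufangCocycle

section

variable {V Z : Type*} [AddCommGroup V] [AddCommGroup Z]

/-- The central extension of `V` by `Z` given by a cocycle. -/
@[ext]
structure Extension (f : MoufangCocycle V Z) where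
  base : V
  fiber : Z

variable (f : MoufangCocycle V Z)

instance : Mul f.Extension where
  mul a b := ⟨a.base + b.base, a.fiber + b.fiber + f.toFun a.base b.base⟩

instance : One f.Extension := ⟨⟨0, 0⟩⟩

@[simp] theorem one_base : (1 : f.Extension).base = 0 := rfl
@[simp] theorem one_fiber : (1 : f.Extension).fiber = 0 := rfl
@[simp] theorem mul_base (a b : f.Extension) : (a * b).base = a.base + b.base := rfl
@[simp] theorem mul_fiber (a b : f.Extension) :
    (a * b).fiber = a.fiber + b.fiber + f.toFun a.base b.base := rfl

instance : MulOneClass f.Extension where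
  one_mul a := by ext <;> simp [f.zero_left]
  mul_one a := by ext <;> simp [f.zero_right]

theorem isMoufangLoop : IsMoufangLoop f.Extension where
  existsUnique_mul_left a b := by
    refine ⟨⟨b.base - a.base, b.fiber - a.fiber - f.toFun a.base (b.base - a.base)⟩, ?_, ?_⟩
    · ext
      · simp
      · simp only [mul_fiber]; abel
    · rintro c rfl
      ext
      · simp
      · simp only [mul_fiber, mul_base, add_sub_cancel_left]; abel
  existsUnique_mul_right a b := by
    refine ⟨⟨b.base - a.base, b.fiber - a.fiber - f.toFun (b.base - a.base) a.base⟩, ?_, ?_⟩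
    · ext
      · simp
      · simp only [mul_fiber]; abel
    · rintro c rfl
      ext
      · simp
      · simp only [mul_fiber, mul_base, add_sub_cancel_right]; abel
  moufang_left x y z := by
    ext
    · simp only [mul_base]; abel
    · simp only [mul_base, mul_fiber]
      linear_combination (norm := abel) f.left x.base y.base z.base
  moufang_right x y z := by
    ext
    · simp only [mul_base]; abel
    · simp only [mul_base, mul_fiber]
      linear_combination (norm := abel) f.right x.base y.base z.base
  moufang_middle x y z := by
    ext
    · simp only [mul_base]; abel
    · simp only [mul_base, mul_fiber]
      linear_combination (norm := abel) f.middle x.base y.base z.base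

/-- The product of a family of cocycles. -/
def pi {ι : Type*} (f : ι → MoufangCocycle V Z) : MoufangCocycle V (ι → Z) where
  toFun x y i := (f i).toFun x y
  zero_left x := funext fun i => (f i).zero_left x
  zero_right x := funext fun i => (f i).zero_right x
  left x y z := funext fun i => (f i).left x y z
  right x y z := funext fun i => (f i).right x y z
  middle x y z := funext fun i => (f i).middle x y z

@[simp] theorem pi_toFun {ι : Type*} (f : ι → MoufangCocycle V Z) (x y : V) (i : ι) :
    (pi f).toFun x y i = (f i).toFun x y := rfl

/-- The projection of the extension by a product of cocycles to the extension by a factor. -/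
def projection {ι : Type*} (f : ι → MoufangCocycle V Z) (i : ι) :
    (pi f).Extension →* (f i).Extension where
  toFun a := ⟨a.base, a.fiber i⟩
  map_one' := rfl
  map_mul' _ _ := rfl

end

/-- The fibre over 0 is a central copy of Z/2 with quotient `V`. Scalar values are essential: this
is why the free cocycle is split into components. -/
theorem isCodeLoop {V : Type} [AddCommGroup V] (hV : ∀ v : V, v + v = 0)
    (f : MoufangCocycle V (ZMod 2)) : IsCodeLoop f.Extension where
  toIsMoufangLoop := f.isMoufangLoop
  exists_central := by
    refine ⟨⟨⟨{a | a.base = 0}, fun {a b} ha hb => ?_⟩, rfl⟩, ?_, ?_, Multiplicative V,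
      inferInstance, ⟨⟨fun a => Multiplicative.ofAdd a.base, rfl⟩, fun a b => rfl⟩, ?_, ?_, ?_⟩
    · exact (congrArg₂ (· + ·) ha hb).trans (add_zero 0)
    · intro a ha
      have ha' : a.base = 0 := ha
      refine ⟨fun b => ?_, fun b c => ?_, fun b c => ?_⟩
      · ext <;> simp [ha', f.zero_left, f.zero_right, add_comm]
      · ext <;> simp [ha', f.zero_left, add_assoc]
      · ext <;> simp [ha', f.zero_right, add_assoc, add_comm, add_left_comm]
    · have e : {a : f.Extension // a.base = 0} ≃ ZMod 2 :=
        { toFun := fun a => a.1.fiber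
          invFun := fun c => ⟨⟨0, c⟩, rfl⟩
          left_inv := fun a => Subtype.ext (Extension.ext a.2.symm rfl)
          right_inv := fun c => rfl }
      exact (Nat.card_congr e).trans (Nat.card_zmod 2)
    · exact fun v => ⟨⟨v.toAdd, 0⟩, rfl⟩
    · exact fun v => hV v.toAdd
    · exact fun a => Iff.rfl

end MoufangCocycle

/-! ### The free loop -/

/-- The index set of a basis of the centre of the free loop: squares, commutators and associators
of the generators. -/
abbrev FreeIndex (n : ℕ) : Type := Fin n ⊕ IndexPair n ⊕ IndexTriple n

/-- The components of the cocycle of the free loop of rank `n` in `𝓔`. -/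
def freeCocycle {n : ℕ} : FreeIndex n → MoufangCocycle (Fin n → ZMod 2) (ZMod 2)
  | .inl i =>
    { toFun := fun x y => x i * y i
      zero_left := by simp
      zero_right := by simp
      left := by intros; simp only [Pi.add_apply]; grind
      right := by intros; simp only [Pi.add_apply]; grind
      middle := by intros; simp only [Pi.add_apply]; grind }
  | .inr (.inl q) =>
    { toFun := fun x y => x q.1.2 * y q.1.1
      zero_left := by simp
      zero_right := by simp
      left := by intros; simp only [Pi.add_apply]; grind
      right := by intros; simp only [Pi.add_apply]; grind
      middle := by intros; simp only [Pi.add_apply]; grind }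
  | .inr (.inr q) =>
    { toFun := fun x y => x q.fst * y q.snd * y q.trd + x q.snd * y q.fst * y q.trd +
        x q.trd * y q.fst * y q.snd
      zero_left := by simp
      zero_right := by simp
      left := by intros; simp only [Pi.add_apply]; grind
      right := by intros; simp only [Pi.add_apply]; grind
      middle := by intros; simp only [Pi.add_apply]; grind }

@[simp] theorem freeCocycle_inl {n : ℕ} (i : Fin n) (x y : Fin n → ZMod 2) :
    (freeCocycle (.inl i)).toFun x y = x i * y i := rfl
@[simp] theorem freeCocycle_inr_inl {n : ℕ} (q : IndexPair n) (x y : Fin n → ZMod 2) :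
    (freeCocycle (.inr (.inl q))).toFun x y = x q.1.2 * y q.1.1 := rfl
@[simp] theorem freeCocycle_inr_inr {n : ℕ} (q : IndexTriple n) (x y : Fin n → ZMod 2) :
    (freeCocycle (.inr (.inr q))).toFun x y = x q.fst * y q.snd * y q.trd +
      x q.snd * y q.fst * y q.trd + x q.trd * y q.fst * y q.snd := rfl

/-- The free loop of rank `n` in `𝓔`. -/
abbrev FreeLoop (n : ℕ) : Type := (MoufangCocycle.pi (freeCocycle (n := n))).Extension

namespace FreeLoop

variable {n : ℕ}

theorem inVarietyGeneratedByCodeLoops (n : ℕ) : InVarietyGeneratedByCodeLoops (FreeLoop n) := by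
  refine ⟨(MoufangCocycle.isMoufangLoop _).toIsLoop, fun s t hst => ?_⟩
  refine (MoufangCocycle.isMoufangLoop _).satisfiesIdentity_of_jointly_injective
    (fun k => ((freeCocycle k).isMoufangLoop).toIsLoop)
    (fun k => MoufangCocycle.projection freeCocycle k) (fun a b hab => ?_)
    (fun k => hst _ ((freeCocycle k).isCodeLoop fun v => funext fun i => CharTwo.add_self_eq_zero (v i)))
  ext k
  -- Any component determines the whole base; `.inl k` is one that certainly exists once there is a
  -- coordinate `k` to compare.
  · exact congrFun (congrArg MoufangCocycle.Extension.base (hab (.inl k))) k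
  · exact congrArg MoufangCocycle.Extension.fiber (hab k)

theorem inVarietyE (n : ℕ) : InVarietyE (FreeLoop n) :=
  (inVarietyGeneratedByCodeLoops n).inVarietyE

theorem isLoop (n : ℕ) : IsLoop (FreeLoop n) := (inVarietyE n).toIsLoop

theorem single_fst_mul_snd (i : Fin n) (w : IndexTriple n) :
    (Pi.single i 1 : Fin n → ZMod 2) w.fst * (Pi.single i 1 : Fin n → ZMod 2) w.snd = 0 :=
  TrialityModel.single_mul_single_eq_zero w.2.1.ne

theorem single_fst_mul_trd (i : Fin n) (w : IndexTriple n) :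
    (Pi.single i 1 : Fin n → ZMod 2) w.fst * (Pi.single i 1 : Fin n → ZMod 2) w.trd = 0 :=
  TrialityModel.single_mul_single_eq_zero (w.2.1.trans w.2.2).ne

theorem single_snd_mul_trd (i : Fin n) (w : IndexTriple n) :
    (Pi.single i 1 : Fin n → ZMod 2) w.snd * (Pi.single i 1 : Fin n → ZMod 2) w.trd = 0 :=
  TrialityModel.single_mul_single_eq_zero w.2.2.ne

/-- The free generators. -/
def gen (i : Fin n) : FreeLoop n := ⟨Pi.single i 1, 0⟩

/-- Extension of a function by a constant. -/
def extend {α : Type*} (f : Fin n → α) (c : α) (i : ℕ) : α := if h : i < n then f ⟨i, h⟩ else c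

@[simp] theorem extend_val {α : Type*} (f : Fin n → α) (c : α) (i : Fin n) :
    extend f c i = f i := dif_pos i.2

theorem sum_indexPair {M : Type*} [AddCommMonoid M] (F : ℕ → ℕ → M) :
    ∑ q : IndexPair n, F q.1.1 q.1.2 = ∑ l ∈ Finset.range n, ∑ i ∈ Finset.range l, F i l := by
  rw [Finset.sum_sigma']
  refine Finset.sum_bij' (fun q _ => ⟨q.1.2, q.1.1⟩)
    (fun a ha => ⟨(⟨a.2, ?_⟩, ⟨a.1, ?_⟩), ?_⟩) ?_ ?_ ?_ ?_ ?_
  · simp only [Finset.mem_sigma, Finset.mem_range] at ha; omega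
  · simp only [Finset.mem_sigma, Finset.mem_range] at ha; omega
  · simp only [Finset.mem_sigma, Finset.mem_range] at ha; exact ha.2
  · intro q _
    simp only [Finset.mem_sigma, Finset.mem_range]
    exact ⟨q.1.2.2, q.2⟩
  · intros; exact Finset.mem_univ _
  · intros; rfl
  · intros; rfl
  · intros; rfl

theorem sum_indexTriple {M : Type*} [AddCommMonoid M] (F : ℕ → ℕ → ℕ → M) :
    ∑ q : IndexTriple n, F q.fst q.snd q.trd =
      ∑ l ∈ Finset.range n, ∑ j ∈ Finset.range l, ∑ i ∈ Finset.range j, F i j l := by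
  simp only [Finset.sum_sigma']
  refine Finset.sum_bij' (fun q _ => ⟨q.trd, q.snd, q.fst⟩)
    (fun a ha => ⟨(⟨a.2.2, ?_⟩, ⟨a.2.1, ?_⟩, ⟨a.1, ?_⟩), ?_⟩) ?_ ?_ ?_ ?_ ?_
  · simp only [Finset.mem_sigma, Finset.mem_range] at ha; omega
  · simp only [Finset.mem_sigma, Finset.mem_range] at ha; omega
  · simp only [Finset.mem_sigma, Finset.mem_range] at ha; omega
  · simp only [Finset.mem_sigma, Finset.mem_range] at ha; exact ⟨ha.2.2, ha.2.1⟩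
  · intro q _
    simp only [Finset.mem_sigma, Finset.mem_range]
    exact ⟨q.trd.2, q.2.2, q.2.1⟩
  · intros; exact Finset.mem_univ _
  · intros; rfl
  · intros; rfl
  · intros; rfl

section Lift

variable {L : Type u} [MulOneClass L] (h : InVarietyE L) (y : Fin n → L)

/-- The central element of `L` attached to a basis element of the centre of the free loop. -/
noncomputable def centralGen : FreeIndex n → InvolutiveCenter L
  | .inl i => h.sq (y i)
  | .inr (.inl q) => h.comm (y q.1.1) (y q.1.2)
  | .inr (.inr q) => h.assoc (y q.fst) (y q.snd) (y q.trd)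

/-- The action of the homomorphism of the universal property on the centre. -/
noncomputable def centralLift (ζ : FreeIndex n → ZMod 2) : InvolutiveCenter L :=
  ∑ k, ζ k • centralGen h y k

theorem centralLift_add (ζ ζ' : FreeIndex n → ZMod 2) :
    centralLift h y (ζ + ζ') = centralLift h y ζ + centralLift h y ζ' := by
  simp only [centralLift, ← Finset.sum_add_distrib, ← add_smul, Pi.add_apply]

/-- `freeCocycle` consists of the coefficients of `normalCocycle`, so only the sums over increasing
pairs and triples have to be reindexed. The paddings 1 and 0 play no role, since only indices below
`n` occur. -/
theorem centralLift_cocycle (x x' : Fin n → ZMod 2) :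
    centralLift h y ((MoufangCocycle.pi freeCocycle).toFun x x') =
      h.normalCocycle (extend y 1) (extend x 0) (extend x' 0) n := by
  have e2 := sum_indexPair (n := n) fun i l => (extend x 0 l * extend x' 0 i) •
    h.comm (extend y 1 i) (extend y 1 l)
  have e3 := sum_indexTriple (n := n) fun i j l => (extend x 0 i * extend x' 0 j * extend x' 0 l +
    extend x 0 j * extend x' 0 i * extend x' 0 l + extend x 0 l * extend x' 0 i * extend x' 0 j) •
    h.assoc (extend y 1 i) (extend y 1 j) (extend y 1 l)
  simp only [extend_val] at e2 e3
  rw [InVarietyE.normalCocycle, Finset.sum_add_distrib, Finset.sum_add_distrib, ← e2, ← e3,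
    Finset.sum_range, centralLift, Fintype.sum_sum_type, Fintype.sum_sum_type]
  simp only [extend_val]
  rfl

/-- The homomorphism of the universal property. -/
noncomputable def lift : FreeLoop n →* L where
  toFun a := centralLift h y a.fiber +ᵥ normalProd (extend y 1) (extend a.base 0) n
  map_one' := by
    have e : extend (0 : Fin n → ZMod 2) 0 = fun _ => 0 := by
      funext i
      simp [extend]
    have e' : centralLift h y 0 = 0 := by simp [centralLift]
    rw [MoufangCocycle.one_base, MoufangCocycle.one_fiber, e, normalProd_zero, e', zero_vadd]
  map_mul' a b := by
    have e : extend (a.base + b.base) 0 = fun i => extend a.base 0 i + extend b.base 0 i := by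
      funext i
      simp only [extend]
      split <;> simp
    rw [MoufangCocycle.mul_base, MoufangCocycle.mul_fiber, centralLift_add, centralLift_add,
      centralLift_cocycle, InvolutiveCenter.vadd_mul, InvolutiveCenter.mul_vadd,
      h.normalProd_mul_normalProd, e, vadd_vadd, vadd_vadd]

theorem lift_gen (i : Fin n) : lift h y (gen i) = y i := by
  have e : extend (Pi.single i 1 : Fin n → ZMod 2) 0 = fun j => if j = (i : ℕ) then 1 else 0 := by
    funext j
    simp only [extend, Pi.single_apply, Fin.ext_iff]
    split
    · rfl
    · rw [if_neg]
      omega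
  have e' : centralLift h y 0 = 0 := by simp [centralLift]
  change centralLift h y 0 +ᵥ normalProd _ (extend (Pi.single i 1 : Fin n → ZMod 2) 0) n = y i
  rw [e', zero_vadd, e, normalProd_single, if_pos i.2, extend_val]

end Lift

/-- This and the next two lemmas realise the basis of the fibre by squares, commutators and
associators of the generators, which is why the generators generate. -/
theorem gen_mul_self (i : Fin n) :
    gen i * gen i = (⟨0, Pi.single (.inl i) 1⟩ : FreeLoop n) := by
  ext k
  · simp [CharTwo.add_self_eq_zero]
  · rcases k with j | q | q
    · simp [gen, Pi.single_apply]
    · simpa [gen] using TrialityModel.single_eq_zero_or_of_ne q.2.ne'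
    · have e : (Pi.single (.inl i) 1 : FreeIndex n → ZMod 2) (.inr (.inr q)) = 0 :=
        Pi.single_eq_of_ne (by simp) 1
      simp only [MoufangCocycle.mul_fiber, Pi.add_apply, MoufangCocycle.pi_toFun, gen,
        freeCocycle_inr_inr, Pi.zero_apply, e]
      grind [single_fst_mul_snd i q, single_fst_mul_trd i q, single_snd_mul_trd i q]

theorem gen_mul_gen_mul (q : IndexPair n) :
    gen q.1.1 * gen q.1.2 * ⟨0, Pi.single (.inr (.inl q)) 1⟩ = gen q.1.2 * gen q.1.1 := by
  ext k
  · simp [add_comm]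
  · rcases k with j | w | w
    · simp [gen, mul_comm]
    · have h := TrialityModel.single_pair_apply q w
      simp [gen]
      grind
    · simp [gen, mul_assoc, single_fst_mul_snd, single_fst_mul_trd, single_snd_mul_trd]

theorem gen_mul_gen_mul_gen_mul (q : IndexTriple n) :
    gen q.fst * (gen q.snd * gen q.trd) * ⟨0, Pi.single (.inr (.inr q)) 1⟩ =
      gen q.fst * gen q.snd * gen q.trd := by
  ext k
  · simp [add_assoc]
  · rcases k with j | w | w
    · simp [gen]
      ring
    · simp [gen]
      ring
    · have e := TrialityModel.single_triple_apply q w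
      simp only [← TrialityModel.single_pair_apply] at e
      simp [gen] at e ⊢
      grind [single_fst_mul_snd q.snd w, single_fst_mul_trd q.snd w, single_snd_mul_trd q.snd w,
        single_fst_mul_snd q.trd w, single_fst_mul_trd q.trd w, single_snd_mul_trd q.trd w]

/-- Every subset that contains the generators and is closed under products and left divisions is
the whole free loop. -/
theorem mem_of_closed {S : Set (FreeLoop n)} (hgen : ∀ i, gen i ∈ S) (h1 : 1 ∈ S)
    (hmul : ∀ a ∈ S, ∀ b ∈ S, a * b ∈ S) (hdiv : ∀ a ∈ S, ∀ b ∈ S, leftDiv a b ∈ S)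
    (a : FreeLoop n) : a ∈ S := by
  have hdiv' {a b c : FreeLoop n} (ha : a ∈ S) (hb : b ∈ S) (e : a * c = b) : c ∈ S := by
    rw [← (isLoop n).leftDiv_eq_iff.mpr e]
    exact hdiv a ha b hb
  have hfib (ζ : FreeIndex n → ZMod 2) : (⟨0, ζ⟩ : FreeLoop n) ∈ S := by
    refine Pi.zmod_two_induction (p := fun ζ => (⟨0, ζ⟩ : FreeLoop n) ∈ S) h1 ?_ ?_ ζ
    · rintro (i | q | q)
      · rw [← gen_mul_self]
        exact hmul _ (hgen i) _ (hgen i)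
      · exact hdiv' (hmul _ (hgen q.1.1) _ (hgen q.1.2)) (hmul _ (hgen q.1.2) _ (hgen q.1.1))
          (gen_mul_gen_mul q)
      · exact hdiv' (hmul _ (hgen q.fst) _ (hmul _ (hgen q.snd) _ (hgen q.trd)))
          (hmul _ (hmul _ (hgen q.fst) _ (hgen q.snd)) _ (hgen q.trd))
          (gen_mul_gen_mul_gen_mul q)
    · intro ζ ζ' hζ hζ'
      convert hmul _ hζ _ hζ' using 1
      ext k
      · simp
      · simp [MoufangCocycle.zero_left]
  have hbase (x : Fin n → ZMod 2) : (⟨x, 0⟩ : FreeLoop n) ∈ S := by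
    refine Pi.zmod_two_induction (p := fun x => (⟨x, 0⟩ : FreeLoop n) ∈ S) h1 hgen ?_ x
    intro x x' hx hx'
    convert hmul _ (hmul _ hx _ hx') _ (hfib ((MoufangCocycle.pi freeCocycle).toFun x x')) using 1
    ext k
    · simp
    · simp [MoufangCocycle.zero_right, CharTwo.add_self_eq_zero]
  convert hmul _ (hbase a.base) _ (hfib a.fiber) using 1
  ext k
  · simp
  · simp [MoufangCocycle.zero_right]

/-- Existence is `lift`. For uniqueness, the set where two homomorphisms agree is closed under
products and left divisions, so `mem_of_closed` applies. -/
theorem isFreeLoopInE (n : ℕ) : IsFreeLoopInE.{u} (FreeLoop n) gen := by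
  refine ⟨inVarietyE n, fun L _ hL y => ⟨lift hL y, lift_gen hL y, fun f hf => ?_⟩⟩
  refine MonoidHom.ext fun a => ?_
  refine mem_of_closed (S := {a | f a = lift hL y a}) (fun i => ?_) ?_ (fun a ha b hb => ?_)
    (fun a ha b hb => ?_) a
  · exact (hf i).trans (lift_gen hL y i).symm
  · exact (map_one f).trans (map_one _).symm
  · change f _ = lift hL y _
    rw [map_mul, map_mul, ha, hb]
  · change f _ = lift hL y _
    rw [(isLoop n).map_leftDiv hL.toIsLoop, (isLoop n).map_leftDiv hL.toIsLoop, ha, hb]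

end FreeLoop

/-- Only finitely many variables occur in `s` and `t`. With `n` bounding them, the valuation factors
through `FreeLoop n`, where the identity is already known. -/
theorem InVarietyE.inVarietyGeneratedByCodeLoops {L : Type u} [MulOneClass L] (h : InVarietyE L) :
    InVarietyGeneratedByCodeLoops L := by
  refine ⟨h.toIsLoop, fun s t hst v => ?_⟩
  let n := max s.bound t.bound
  let f : FreeLoop n →* L := FreeLoop.lift h fun i => v i
  let w : ℕ → FreeLoop n := FreeLoop.extend FreeLoop.gen 1
  have hw (i : ℕ) (hi : i < n) : f (w i) = v i := by
    have e : w i = FreeLoop.gen ⟨i, hi⟩ := dif_pos hi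
    rw [e]
    exact FreeLoop.lift_gen h _ _
  have e := congrArg f ((FreeLoop.inVarietyGeneratedByCodeLoops n).2 s t hst w)
  rw [(FreeLoop.isLoop n).map_eval h.toIsLoop, (FreeLoop.isLoop n).map_eval h.toIsLoop,
    LoopTerm.eval_congr (w := v) fun i hi => hw i (lt_max_of_lt_left hi),
    LoopTerm.eval_congr (w := v) fun i hi => hw i (lt_max_of_lt_right hi)] at e
  exact e

/-! ### The loop of the model is free -/

namespace TrialityModel

variable {n : ℕ}

/-- The element `x⁻¹ x^σ` of the model that corresponds to an element of the free loop, where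
`x = ∏ a_i^ξ_i` up to central factors. -/
def ofFreeLoop (w : FreeLoop n) : TrialityModel n where
  α := w.base
  β := w.base
  s i := w.fiber (.inl i) + w.base i
  r i := w.fiber (.inl i)
  u q := w.fiber (.inr (.inl q))
  v q := w.fiber (.inr (.inl q)) + w.base q.1.1 * w.base q.1.2
  p _ := 0
  z q := w.fiber (.inr (.inr q)) + w.base q.fst * w.base q.snd * w.base q.trd
  t q := w.fiber (.inr (.inr q)) + w.base q.fst * w.base q.snd * w.base q.trd

section Components

variable (w : FreeLoop n) (i : Fin n) (q : IndexPair n) (k : IndexTriple n)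

@[simp] theorem ofFreeLoop_α : (ofFreeLoop w).α i = w.base i := rfl
@[simp] theorem ofFreeLoop_β : (ofFreeLoop w).β i = w.base i := rfl
@[simp] theorem ofFreeLoop_s : (ofFreeLoop w).s i = w.fiber (.inl i) + w.base i := rfl
@[simp] theorem ofFreeLoop_r : (ofFreeLoop w).r i = w.fiber (.inl i) := rfl
@[simp] theorem ofFreeLoop_u : (ofFreeLoop w).u q = w.fiber (.inr (.inl q)) := rfl
@[simp] theorem ofFreeLoop_v : (ofFreeLoop w).v q =
    w.fiber (.inr (.inl q)) + w.base q.1.1 * w.base q.1.2 := rfl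
@[simp] theorem ofFreeLoop_p : (ofFreeLoop w).p q = 0 := rfl
@[simp] theorem ofFreeLoop_z : (ofFreeLoop w).z k =
    w.fiber (.inr (.inr k)) + w.base k.fst * w.base k.snd * w.base k.trd := rfl
@[simp] theorem ofFreeLoop_t : (ofFreeLoop w).t k =
    w.fiber (.inr (.inr k)) + w.base k.fst * w.base k.snd * w.base k.trd := rfl

end Components

/-- The element `x` with `ofFreeLoop w = x⁻¹ x^σ`. -/
def preimage (w : FreeLoop n) : TrialityModel n where
  α := w.base
  β := 0
  s i := w.fiber (.inl i)
  r := 0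
  -- The product term cancels the one that inversion adds, so `x⁻¹ x^σ` has `u`-coordinate
  -- `w.fiber`.
  u q := w.fiber (.inr (.inl q)) + w.base q.1.1 * w.base q.1.2
  v := 0
  p := 0
  z q := w.fiber (.inr (.inr q)) + w.base q.fst * w.base q.snd * w.base q.trd
  t := 0

theorem preimage_gen (i : Fin n) : preimage (FreeLoop.gen i) = a i := by
  ext q <;> simp [preimage, FreeLoop.gen]
  · exact single_eq_zero_or_of_ne q.2.ne
  · exact Or.inl (single_eq_zero_or_of_ne q.2.1.ne)

theorem ofFreeLoop_eq (w : FreeLoop n) :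
    ofFreeLoop w = (preimage w)⁻¹ * sigma n (preimage w) := by
  ext q <;> simp [sigma_apply, preimage] <;> grind

theorem ofFreeLoop_injective : Function.Injective (ofFreeLoop (n := n)) := by
  intro w w' e
  have hb : w.base = w'.base := congrArg TrialityModel.α e
  ext k
  · rw [hb]
  · rcases k with i | q | q
    · exact congrFun (congrArg TrialityModel.r e) i
    · exact congrFun (congrArg TrialityModel.u e) q
    · have e' := congrFun (congrArg TrialityModel.z e) q
      rw [ofFreeLoop_z, ofFreeLoop_z, hb] at e'
      exact add_right_cancel e'

theorem exists_ofFreeLoop_eq (x : TrialityModel n) :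
    ∃ w : FreeLoop n, ofFreeLoop w = x⁻¹ * sigma n x := by
  -- The fibre is read off from the coordinates `r`, `u` and `z`, from which `ofFreeLoop` recovers
  -- it; for `z` the cubic term in the base is removed.
  refine ⟨⟨fun i => x.α i + x.β i, Sum.elim (fun i => (x⁻¹ * sigma n x).r i)
    (Sum.elim (fun q => (x⁻¹ * sigma n x).u q) fun q => (x⁻¹ * sigma n x).z q +
      (x.α q.fst + x.β q.fst) * (x.α q.snd + x.β q.snd) * (x.α q.trd + x.β q.trd))⟩, ?_⟩
  ext q
  · simp [sigma_apply]
  · simp [sigma_apply]; ring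
  · simp [sigma_apply]; grind [ZMod.two_mul_self (x.α q), ZMod.two_mul_self (x.β q)]
  · simp [sigma_apply]
  · simp [sigma_apply]
  · simp [sigma_apply]; grind
  · simp [sigma_apply]; grind
  · simp [sigma_apply]; grind
  · simp [sigma_apply]; grind

/-- The link between the two sides: on elements `x⁻¹ x^σ` the triality product collapses to addition
of coordinates plus the free cocycle. -/
theorem ofFreeLoop_mul (w w' : FreeLoop n) : ofFreeLoop (w * w') =
    rho n (ofFreeLoop w)⁻¹ * ofFreeLoop w' * rho n (rho n (ofFreeLoop w)⁻¹) := by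
  ext q
  · simp [rho_apply]; grind
  · simp [rho_apply]; grind
  · simp [rho_apply]
    grind [ZMod.two_mul_self (w.base q), ZMod.two_mul_self (w'.base q)]
  · simp [rho_apply]
    grind [ZMod.two_mul_self (w.base q), ZMod.two_mul_self (w'.base q)]
  · simp [rho_apply]; grind
  · simp [rho_apply]; grind
  · simp [rho_apply]; grind
  · simp [rho_apply]; grind
  · simp [rho_apply]; grind

end TrialityModel

/-- Membership in `𝓔` is moved across `e` through the description by identities of code loops,
instead of one defining condition at a time. -/
theorem IsFreeLoopInE.of_mulEquiv {n : ℕ} {F M : Type} [MulOneClass F] [MulOneClass M]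
    {x : Fin n → F} (h : IsFreeLoopInE.{u} F x) (e : F ≃* M) :
    IsFreeLoopInE.{u} M fun i => e (x i) := by
  have hM : IsLoop M := h.1.toIsLoop.of_mulEquiv e
  have hME : InVarietyE M := InVarietyGeneratedByCodeLoops.inVarietyE ⟨hM, fun s t hst =>
    hM.satisfiesIdentity_of_jointly_injective (ι := Unit) (M := fun _ => F)
      (fun _ => h.1.toIsLoop) (fun _ => e.symm.toMonoidHom)
      (fun a b hab => e.symm.injective (hab ())) fun _ =>
        h.1.inVarietyGeneratedByCodeLoops.2 s t hst⟩
  refine ⟨hME, fun L _ hL y => ?_⟩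
  obtain ⟨f, hf, hu⟩ := h.2 L hL y
  refine ⟨f.comp e.symm.toMonoidHom, fun i => ?_, fun g hg => ?_⟩
  · simpa using hf i
  · rw [← hu (g.comp e.toMonoidHom) hg]
    ext m
    simp

/-! ### The loop of `G_n`. -/

namespace TrialityGroup

variable {n : ℕ}

theorem equivModel_toLoop_preimage
    (h : IsTriality (conjModel n (TrialityModel.sigma n)) (conjModel n (TrialityModel.rho n)))
    (w : FreeLoop n) :
    equivModel n (h.toLoop ((equivModel n).symm (TrialityModel.preimage w))).1 =
      TrialityModel.ofFreeLoop w := by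
  simp [IsTriality.toLoop, equivModel_conjModel, TrialityModel.ofFreeLoop_eq]

/-- The free loop of rank `n` in `𝓔` is the loop of `G_n`. -/
noncomputable def freeLoopEquiv
    (h : IsTriality (conjModel n (TrialityModel.sigma n)) (conjModel n (TrialityModel.rho n))) :
    FreeLoop n ≃* h.LoopOf :=
  MulEquiv.ofBijective
    ({ toFun := fun w => h.toLoop ((equivModel n).symm (TrialityModel.preimage w))
       map_mul' := fun w w' => by
        have key := equivModel_toLoop_preimage h
        refine Subtype.ext ((equivModel n).injective ?_)
        rw [key, TrialityModel.ofFreeLoop_mul, ← key w, ← key w']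
        change _ = equivModel n (conjModel n (TrialityModel.rho n) _⁻¹ * _ *
          conjModel n (TrialityModel.rho n) (conjModel n (TrialityModel.rho n) _⁻¹))
        simp only [map_mul, equivModel_conjModel, map_inv] } : FreeLoop n →ₙ* h.LoopOf) (by
    have key := equivModel_toLoop_preimage h
    constructor
    · intro w w' e
      apply TrialityModel.ofFreeLoop_injective
      rw [← key w, ← key w']
      exact congrArg (fun m => equivModel n m.1) e
    · rintro ⟨m, x, rfl⟩
      obtain ⟨w, hw⟩ := TrialityModel.exists_ofFreeLoop_eq (equivModel n x)
      refine ⟨w, Subtype.ext ((equivModel n).injective ((key w).trans ?_))⟩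
      rw [hw]
      simp [equivModel_conjModel])

theorem freeLoopEquiv_gen
    (h : IsTriality (conjModel n (TrialityModel.sigma n)) (conjModel n (TrialityModel.rho n)))
    (i : Fin n) : freeLoopEquiv h (FreeLoop.gen i) = h.toLoop (a i) := by
  change h.toLoop ((equivModel n).symm (TrialityModel.preimage (FreeLoop.gen i))) = _
  rw [TrialityModel.preimage_gen, equivModel_symm_a]

end TrialityGroup

theorem mainTheorem1 (n : ℕ) (hn : 3 ≤ n) :
    -- `G_n` is nilpotent of class `3` and has order `2 ^ (4n + m)`
    (∃ _ : Group.IsNilpotent (TrialityGroup n), Group.nilpotencyClass (TrialityGroup n) = 3) ∧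
    Nat.card (TrialityGroup n) = 2 ^ (4 * n + (3 * n.choose 2 + 2 * n.choose 3)) ∧
    -- the variety `𝓔` is generated by code loops
    (∀ (L : Type u) [MulOneClass L], InVarietyE L ↔ InVarietyGeneratedByCodeLoops L) ∧
    -- `G_n` is a group with triality, and `L(G_n)` is the free loop of rank `n` in `𝓔`
    ∃ (σ ρ : MulAut (TrialityGroup n)) (h : IsTriality σ ρ),
      (∀ i : Fin n, σ (TrialityGroup.a i) = TrialityGroup.b i ∧
        σ (TrialityGroup.b i) = TrialityGroup.a i) ∧
      (∀ i : Fin n, ρ (TrialityGroup.a i) = TrialityGroup.b i ∧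
        ρ (TrialityGroup.b i) = (TrialityGroup.a i)⁻¹ * (TrialityGroup.b i)⁻¹) ∧
      IsFreeLoopInE.{u} h.LoopOf (fun i : Fin n => h.toLoop (TrialityGroup.a i)) := by
  refine ⟨TrialityGroup.exists_isNilpotent_and_nilpotencyClass_eq hn, TrialityGroup.natCard n,
    fun L _ => ⟨fun h => h.inVarietyGeneratedByCodeLoops, fun h => h.inVarietyE⟩,
    TrialityGroup.conjModel n (TrialityModel.sigma n),
    TrialityGroup.conjModel n (TrialityModel.rho n),
    TrialityGroup.isTriality (by omega), fun i => ⟨?_, ?_⟩, fun i => ⟨?_, ?_⟩, ?_⟩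
  · simp [TrialityGroup.conjModel_apply, TrialityModel.sigma_a]
  · simp [TrialityGroup.conjModel_apply, TrialityModel.sigma_b]
  · simp [TrialityGroup.conjModel_apply, TrialityModel.rho_a]
  · simp [TrialityGroup.conjModel_apply, TrialityModel.rho_b]
  · have h := TrialityGroup.isTriality (n := n) (by omega)
    have key := (FreeLoop.isFreeLoopInE.{u} n).of_mulEquiv (TrialityGroup.freeLoopEquiv h)
    simpa only [TrialityGroup.freeLoopEquiv_gen] using key
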